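/- Identify $\mathbb R^2$ with $\mathbb C$, let $\Omega$ be the open unit disc, and put $n_\varphi=(\cos\varphi,\sin\varphi)$. For $\mu\in C_c^\infty(\mathbb R^2;\mathbb C)$ let $R\mu(\varphi,s)=\int_{n_\varphi\cdot x=s}\mu\,d\ell$ be its Radon transform ($d\ell$ is arc length) and define $$(T_1^a\mu)(t,e^{i\varphi})=e^{-i\varphi}\,\partial_t\big[R\mu(-\varphi,-\tfrac t2)\big],\qquad (t,e^{i\varphi})\in\mathbb R\times S^1 .$$ **Theorem.** (0) $T_1^a$ is the boundary-averaged single-scattering operator. For $\mu\in C_c^\infty(\Omega)$ let $$v_1(x,k)=-i\bar k\,\frac1\pi\int_{\mathbb C}\frac{e^{-2i\,\mathrm{Re}(kx')}\mu(x')}{x-x'}\,d^2x',\qquad \widehat v_1(x,t,e^{i\varphi})=\int_{\mathbb R}e^{-it\tau}\,v_1(x,\tau e^{i\varphi})\,d\tau\quad(x\in\partial\Omega).$$ Then these integrals converge absolutely and $$\frac1{2\pi i}\int_{\partial\Omega}\widehat v_1(x,t,e^{i\varphi})\,dx=(T_1^a\mu)(t,e^{i\varphi}).$$ (1) $R\mu$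 is smooth in $(\varphi,s)$ and $T_1^a$ maps $C_c^\infty(\mathbb R^2)$ into $C_c^\infty(\mathbb R\times S^1)$. Fix a normalisation $\kappa>0$ of the invariant measure $\kappa\,dt\,d\varphi$ ($0\le\varphi<2\pi$) on $\mathbb R\times S^1$, and let $\mathbb R^2$ carry Lebesgue measure. Then $T_1^a$ has an $L^2$-adjoint $(T_1^a)^*:C_c^\infty(\mathbb R\times S^1)\to C^\infty(\mathbb R^2)$, and $(T_1^a)^*T_1^a$ is a pseudodifferential operator of order $1$ on $\Omega$ with principal symbol $$\sigma_{\rm prin}\big((T_1^a)^*T_1^a\big)(x,\zeta)=2\pi\kappa\,|\zeta|,\qquad x\in\Omega,\ \zeta\in\mathbb R^2\setminus0 .$$ (2) There is a smoothing integral operator $K$ on $\Omega$ (a pseudodifferential operator of order $-1$ with locally integrable kernel on $\Omega\times\Omega$) such that, for all $\mu\in C_c^\infty(\Omega)$, $$\frac1{2\pi\kappa}(-\Delta)^{-1/2}(T_1^a)^*T_1^a\,\mu=\mu+K\mu\quad\text{on }\Omega .$$ Here $(-\Delta)^{-1/2}$ is the Fourier multiplier $|\zeta|^{-1}$ on $\mathbb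 R^2$; with $f=(T_1^a)^*T_1^a\mu$ and $\widehat f(\zeta)=\int e^{-ix\cdot\zeta}f(x)\,dx$, both $f$ and $|\zeta|^{-1}\widehat f$ are in $L^1(\mathbb R^2)$. Thus the constants are $2\pi^2$ and $\frac1{2\pi^2}$ for the normalisation $\kappa=\pi$; for the measure $dt\,d\varphi$ itself ($\kappa=1$) they are $2\pi$ and $\frac1{2\pi}$. Conventions: a pseudodifferential operator of order $m$ on $\Omega$ is an operator on $C_c^\infty(\Omega)$ of the form $u\mapsto(2\pi)^{-2}\int e^{ix\cdot\zeta}a(x,\zeta)\widehat u(\zeta)\,d\zeta$ with $a\in S^m_{1,0}(\Omega\times\mathbb R^2)$, plus an integral operator with kernel in $C^\infty(\Omega\times\Omega)$. Its principal symbol is the function $p$, smooth for $\zeta\ne0$ and positively homogeneous of degree $m$ in $\zeta$, such that $a-p$ satisfies the $S^{m-1}_{1,0}$ estimates for $|\zeta|\ge1$. -/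

import Mathlib

open scoped ContDiff ComplexConjugate

noncomputable section

namespace CGORadon

/-! Throughout, the plane `ℝ²` is identified with `ℂ`; `inner ℝ x ζ = x₁ ζ₁ + x₂ ζ₂` is the
Euclidean inner product, `‖ζ‖` the Euclidean norm, and integrals over `ℂ` are with respect to
Lebesgue measure. -/

/-- The unit disc `Ω`. -/
def disc : Set ℂ := Metric.ball 0 1

/-- `u ∈ C_c^∞(U)`: smooth (in the real sense), with compact support contained in `U`. -/
def IsTest (U : Set ℂ) (u : ℂ → ℂ) : Prop :=
  ContDiff ℝ ∞ u ∧ HasCompactSupport u ∧ tsupport u ⊆ U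

/-! ### Single scattering -/

/-- The solid Cauchy transform `∂̄⁻¹ f (x) = (1/π) ∫ f(x') / (x - x') d²x'`. -/
def cauchyTransform (f : ℂ → ℂ) (x : ℂ) : ℂ :=
  (Real.pi : ℂ)⁻¹ * ∫ x' : ℂ, (x - x')⁻¹ * f x'

/-- The unimodular function `e_{-k}(x) = e^{-2 i Re (k x)}`. -/
def eNeg (k x : ℂ) : ℂ := Complex.exp (-(2 * Complex.I * ((k * x).re : ℂ)))

/-- The single scattering term `v₁(x, k) = - i k̄ ∂̄⁻¹ (e_{-k} μ) (x)`. -/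
def singleScattering (mu : ℂ → ℂ) (x k : ℂ) : ℂ :=
  -Complex.I * conj k * cauchyTransform (fun x' => eNeg k x' * mu x') x

/-- `(T₁ μ)(x, t, e^{iφ}) = ∫ e^{-i t τ} v₁(x, τ e^{iφ}) dτ`: the single scattering term in
pseudo-time. -/
def T1 (mu : ℂ → ℂ) (x : ℂ) (t φ : ℝ) : ℂ :=
  ∫ τ : ℝ, Complex.exp (-(Complex.I * t * τ)) *
    singleScattering mu x (τ * Complex.exp (Complex.I * φ))

/-- The complex average `(1 / 2πi) ∫_{∂Ω} (T₁ μ)(x, t, e^{iφ}) dx` over the (positively oriented)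
unit circle. -/
def boundaryAverage (mu : ℂ → ℂ) (t φ : ℝ) : ℂ :=
  (2 * Real.pi * Complex.I)⁻¹ * ∮ x in C(0, 1), T1 mu x t φ

/-! ### The Radon transform and the averaged operator -/

/-- The Radon transform `Rμ(φ, s)`: the integral of `μ` with respect to arc length over the line
`{x : n_φ · x = s}`, `n_φ = (cos φ, sin φ)`. -/
def radon (mu : ℂ → ℂ) (φ s : ℝ) : ℂ :=
  ∫ r : ℝ, mu (Complex.exp (Complex.I * φ) * (s + r * Complex.I))

/-- `(T₁ᵃ μ)(t, e^{iφ}) = e^{-iφ} ∂_t [Rμ(-φ, -t/2)]`. -/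
def T1a (mu : ℂ → ℂ) (t φ : ℝ) : ℂ :=
  Complex.exp (-(Complex.I * φ)) * deriv (fun t' : ℝ => radon mu (-φ) (-t' / 2)) t

/-- `g ∈ C_c^∞(ℝ × S¹)`, as a function of `(t, φ)` which is `2π`-periodic in `φ`. -/
def IsTestCyl (g : ℝ → ℝ → ℂ) : Prop :=
  ContDiff ℝ ∞ (fun p : ℝ × ℝ => g p.1 p.2) ∧
  (∀ t φ, g t (φ + 2 * Real.pi) = g t φ) ∧
  ∃ M : ℝ, ∀ t φ, M < |t| → g t φ = 0

/-- The `L²` inner product on `ℝ × S¹` with respect to the measure `κ dt dφ`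
(linear in the first argument). -/
def innerCyl (κ : ℝ) (f g : ℝ → ℝ → ℂ) : ℂ :=
  κ * ∫ φ in (0 : ℝ)..(2 * Real.pi), ∫ t : ℝ, f t φ * conj (g t φ)

/-- `S : C_c^∞(ℝ × S¹) → C^∞(ℝ²)` is the (formal) adjoint `(T₁ᵃ)^*` of
`T₁ᵃ : C_c^∞(ℝ²) → C_c^∞(ℝ × S¹)` with respect to `κ dt dφ` on `ℝ × S¹` and Lebesgue measure
on `ℝ²`. -/
def IsAdjointT1a (κ : ℝ) (S : (ℝ → ℝ → ℂ) → ℂ → ℂ) : Prop :=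
  ∀ g, IsTestCyl g → ContDiff ℝ ∞ (S g) ∧
    ∀ ψ, IsTest Set.univ ψ → innerCyl κ (T1a ψ) g = ∫ x : ℂ, ψ x * conj (S g x)

/-! ### Pseudodifferential operators -/

/-- `û(ζ) = ∫ e^{-i x·ζ} u(x) dx`. -/
def ft (u : ℂ → ℂ) (ζ : ℂ) : ℂ :=
  ∫ x : ℂ, Complex.exp (-(Complex.I * (inner ℝ x ζ : ℝ))) * u x

/-- `(2π)^{-2} ∫ e^{i x·ζ} a(x, ζ) û(ζ) dζ`: the quantization of the symbol `a`. -/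
def opOf (a : ℂ → ℂ → ℂ) (u : ℂ → ℂ) (x : ℂ) : ℂ :=
  ((2 * Real.pi : ℂ) ^ 2)⁻¹ *
    ∫ ζ : ℂ, Complex.exp (Complex.I * (inner ℝ x ζ : ℝ)) * (a x ζ * ft u ζ)

/-- The estimates `|∂_x^α ∂_ζ^β b(x, ζ)| ≤ C (1 + |ζ|)^{m - |β|}` for all multi-indices, locally
uniformly for `x ∈ U`, in the region `|ζ| ≥ r`. -/
def SymbolBound (U : Set ℂ) (m r : ℝ) (b : ℂ → ℂ → ℂ) : Prop :=
  ∀ L : Set ℂ, IsCompact L → L ⊆ U → ∀ i j : ℕ, ∃ C : ℝ, ∀ x ∈ L, ∀ ζ : ℂ, r ≤ ‖ζ‖ →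
    ‖iteratedFDeriv ℝ i (fun y => iteratedFDeriv ℝ j (fun η => b y η) ζ) x‖
      ≤ C * (1 + ‖ζ‖) ^ (m - j)

/-- `a ∈ S^m_{1,0}(U × ℝ²)`. -/
def IsSymbol (U : Set ℂ) (m : ℝ) (a : ℂ → ℂ → ℂ) : Prop :=
  ContDiffOn ℝ ∞ (fun p : ℂ × ℂ => a p.1 p.2) (U ×ˢ Set.univ) ∧ SymbolBound U m 0 a

/-- On `C_c^∞(U)` and at points of `U`, the operator `A` equals the quantization of `a` up to an
integral operator with kernel in `C^∞(U × U)`. -/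
def HasFullSymbol (U : Set ℂ) (A : (ℂ → ℂ) → ℂ → ℂ) (a : ℂ → ℂ → ℂ) : Prop :=
  ∃ k : ℂ → ℂ → ℂ, ContDiffOn ℝ ∞ (fun p : ℂ × ℂ => k p.1 p.2) (U ×ˢ U) ∧
    ∀ u, IsTest U u → ∀ x ∈ U, A u x = opOf a u x + ∫ y : ℂ, k x y * u y

/-- `A : C_c^∞(U) → C^∞(U)` is a pseudodifferential operator of order `m` on `U`. -/
def IsPDO (U : Set ℂ) (m : ℝ) (A : (ℂ → ℂ) → ℂ → ℂ) : Prop :=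
  ∃ a, IsSymbol U m a ∧ HasFullSymbol U A a

/-- `A` is a pseudodifferential operator of order `m` on `U` with (homogeneous) principal symbol
`p`: the function `p` is smooth on `U × (ℝ² \ 0)` and positively homogeneous of degree `m` in `ζ`,
and a full symbol of `A` differs from `p` by a symbol of order `m - 1` for large `ζ`. -/
def HasPrincipalSymbol (U : Set ℂ) (m : ℝ) (A : (ℂ → ℂ) → ℂ → ℂ) (p : ℂ → ℂ → ℂ) : Prop :=
  ContDiffOn ℝ ∞ (fun q : ℂ × ℂ => p q.1 q.2) (U ×ˢ {0}ᶜ) ∧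
  (∀ x ∈ U, ∀ ζ : ℂ, ζ ≠ 0 → ∀ c : ℝ, 0 < c → p x (c * ζ) = ((c ^ m : ℝ) : ℂ) * p x ζ) ∧
  ∃ a, IsSymbol U m a ∧ HasFullSymbol U A a ∧
    SymbolBound U (m - 1) 1 (fun x ζ => a x ζ - p x ζ)

/-- `A` is given on `C_c^∞(U)` by a locally integrable kernel on `U × U`. -/
def IsIntegralOperator (U : Set ℂ) (A : (ℂ → ℂ) → ℂ → ℂ) : Prop :=
  ∃ k : ℂ → ℂ → ℂ,
    MeasureTheory.LocallyIntegrableOn (fun p : ℂ × ℂ => k p.1 p.2) (U ×ˢ U) ∧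
    ∀ u, IsTest U u → ∀ x ∈ U,
      MeasureTheory.Integrable (fun y : ℂ => k x y * u y) ∧ A u x = ∫ y : ℂ, k x y * u y

/-- `f` belongs to the domain on which the Fourier multiplier `(-Δ)^{-1/2}` is given by absolutely
convergent integrals: `f ∈ L¹` and `|ζ|⁻¹ f̂ ∈ L¹`. -/
def InDomInvSqrtLaplacian (f : ℂ → ℂ) : Prop :=
  MeasureTheory.Integrable f ∧ MeasureTheory.Integrable (fun ζ : ℂ => (‖ζ‖⁻¹ : ℂ) * ft f ζ)

/-- `(-Δ)^{-1/2} f`, the Fourier multiplier on `ℝ²` with symbol `|ζ|⁻¹`. -/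
def invSqrtLaplacian (f : ℂ → ℂ) : ℂ → ℂ := opOf (fun _ ζ => (‖ζ‖⁻¹ : ℂ)) f

end CGORadon

end

noncomputable section

namespace CGORadon

open MeasureTheory Set Filter Topology FourierTransform

/-! ### Smooth dependence of integrals on parameters -/

/-! The normal operator is exactly the Fourier multiplier `2πκ|ζ|`, on all of `ℝ²`, so filtered
back-projection is exact and `K = 0` serves as the smoothing operator.

Integration by parts in `t` gives the adjoint explicitly as `backProj`, and testing against smooth
functions shows that any adjoint agrees with it on `C_c^∞`. In the composition the phases `e^{±iφ}`
cancel, leaving `-(κ/2) ∫ ∂_s² Rμ(θ, n_θ·x) dθ`. By the Fourier slice theorem `∂_s² Rμ` has line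
transform `-σ² μ̂(σ n_θ)`; in polar coordinates `σ² dσ dθ` is `|ζ| dζ`, and each `ζ` is met twice,
as `(σ, θ)` and `(-σ, θ + π)`. This is `backProj_T1a_eq_opOf`.

Two points about `|D|`, the multiplier `|ζ|`, come from the singularity of its symbol at the origin.
For the symbol calculus, a cutoff splits `|ζ|` into a smooth symbol, controlled by homogeneity, and
a compactly supported part whose kernel is smooth. For inversion one needs `|D|μ ∈ L¹`, which
follows by writing `|D|μ` as a constant times the integral of second differences against `|y|⁻³`,
absolutely integrable in `(x, y)` jointly.

For single scattering, fix `x` on the circle. Since `μ` is supported in the open disc, `F_x(x') =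
μ(x')/(x - x')` is again a test function. The slice theorem and one-dimensional inversion give
`T₁μ(x, ·) = T₁ᵃ F_x`. Cauchy's formula averages `F_x` to `μ`, and the average commutes with the
Radon transform and with `∂_s`. -/

lemma contDiff_congr {E F : Type*} [NormedAddCommGroup E] [NormedSpace ℝ E]
    [NormedAddCommGroup F] [NormedSpace ℝ F] {n : WithTop ℕ∞} {f g : E → F} (h : ∀ x, f x = g x) :
    ContDiff ℝ n f ↔ ContDiff ℝ n g := by
  rw [funext h]

/-- The integral is a convolution with parameter, evaluated at the constant point `0`; the bump
makes the second factor compactly supported and equals `1` where `f` lives. Only integrability of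
`f` is asked, so that indicators and weights singular at the origin are allowed. -/
lemma contDiff_integral_mul {P G : Type*} [NormedAddCommGroup P] [NormedSpace ℝ P]
    [NormedAddCommGroup G] [NormedSpace ℝ G] [FiniteDimensional ℝ G] [MeasurableSpace G]
    [BorelSpace G] {μ : Measure G} {f : G → ℂ} {k : Set G} (hk : IsCompact k)
    (hf : Integrable f μ) (hf0 : ∀ y, y ∉ k → f y = 0) {h : P → G → ℂ}
    (hh : ContDiff ℝ ∞ (fun q : P × G => h q.1 q.2)) :
    ContDiff ℝ ∞ (fun p => ∫ y, f y * h p y ∂μ) := by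
  obtain ⟨R, hR, hkR⟩ := hk.isBounded.subset_closedBall_lt 0 (0 : G)
  let χ : ContDiffBump (0 : G) := ⟨R, R + 1, hR, by linarith⟩
  have key := contDiffOn_convolution_right_with_param_comp (𝕜 := ℝ) (μ := μ) (n := ⊤)
    (ContinuousLinearMap.mul ℝ ℂ) (s := (univ : Set P)) (v := fun _ => (0 : G))
    contDiffOn_const (f := f) (g := fun p z => ((χ (-z) : ℝ) : ℂ) * h p (-z))
    (k := Metric.closedBall 0 (R + 1)) isOpen_univ (isCompact_closedBall _ _) ?_
    hf.locallyIntegrable ?_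
  · rw [contDiffOn_univ] at key
    refine (contDiff_congr fun p => ?_).1 key
    simp only [convolution, ContinuousLinearMap.mul_apply', zero_sub, neg_neg]
    refine integral_congr_ae (Eventually.of_forall fun y => ?_)
    by_cases hy : y ∈ k
    · have : χ y = 1 := χ.one_of_mem_closedBall (hkR hy)
      simp [this]
    · simp [hf0 y hy]
  · intro p x _ hx
    have : χ (-x) = 0 := by
      apply χ.zero_of_le_dist
      simp only [Metric.mem_closedBall, not_le] at hx
      simpa using hx.le
    simp [this]
  · rw [univ_prod_univ, contDiffOn_univ]
    refine ContDiff.mul ?_ ?_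
    · exact Complex.ofRealCLM.contDiff.comp (χ.contDiff.comp contDiff_snd.neg)
    · exact hh.comp (contDiff_fst.prodMk contDiff_snd.neg)

lemma contDiff_setIntegral {P G : Type*} [NormedAddCommGroup P] [NormedSpace ℝ P]
    [NormedAddCommGroup G] [NormedSpace ℝ G] [FiniteDimensional ℝ G] [MeasurableSpace G]
    [BorelSpace G] {μ : Measure G} [IsFiniteMeasureOnCompacts μ] {k : Set G} (hk : IsCompact k)
    {h : P → G → ℂ} (hh : ContDiff ℝ ∞ (fun q : P × G => h q.1 q.2)) :
    ContDiff ℝ ∞ (fun p => ∫ y in k, h p y ∂μ) := by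
  have := contDiff_integral_mul (μ := μ) hk (f := k.indicator fun _ => 1)
    ((integrable_indicator_iff hk.measurableSet).2 (integrableOn_const hk.measure_lt_top.ne))
    (fun y hy => indicator_of_notMem hy _) hh
  refine (contDiff_congr fun p => ?_).1 this
  rw [← integral_indicator hk.measurableSet]
  congr 1 with y
  by_cases hy : y ∈ k <;> simp [hy]

lemma contDiff_intervalIntegral {P : Type*} [NormedAddCommGroup P] [NormedSpace ℝ P] {a b : ℝ}
    (hab : a ≤ b) {h : P → ℝ → ℂ} (hh : ContDiff ℝ ∞ (fun q : P × ℝ => h q.1 q.2)) :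
    ContDiff ℝ ∞ (fun p => ∫ y in a..b, h p y) := by
  refine (contDiff_congr fun p => ?_).1
    (contDiff_setIntegral (μ := volume) (isCompact_Icc (a := a) (b := b)) hh)
  rw [intervalIntegral.integral_of_le hab, integral_Icc_eq_integral_Ioc]

/-! ### The one-dimensional Fourier transform -/

/-- `ĝ(σ) = ∫ e^{-i σ s} g(s) ds`. -/
def ftLine (g : ℝ → ℂ) (σ : ℝ) : ℂ := ∫ s : ℝ, Complex.exp (-(Complex.I * σ * s)) * g s

lemma ftLine_eq (g : ℝ → ℂ) (σ : ℝ) : ftLine g σ = 𝓕 g ((2 * Real.pi)⁻¹ * σ) := by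
  rw [Real.fourier_eq', ftLine]
  congr 1 with s
  rw [smul_eq_mul]
  congr 2
  have : (Real.pi : ℂ) ≠ 0 := by simp [Real.pi_ne_zero]
  simp
  field_simp

lemma integrable_ftLine {g : ℝ → ℂ} (hg : ContDiff ℝ ∞ g) (hc : HasCompactSupport g) :
    Integrable (ftLine g) := by
  have h1 : Integrable (𝓕 g) := by
    have := (𝓕 (hc.toSchwartzMap hg)).integrable (μ := volume)
    rwa [SchwartzMap.fourier_coe] at this
  have := h1.comp_mul_left' (R := (2 * Real.pi)⁻¹) (by positivity)
  exact this.congr (Eventually.of_forall fun σ => (ftLine_eq g σ).symm)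

lemma integral_exp_mul_ftLine {g : ℝ → ℂ} (hg : ContDiff ℝ ∞ g) (hc : HasCompactSupport g)
    (s : ℝ) : ∫ σ : ℝ, Complex.exp (Complex.I * σ * s) * ftLine g σ = 2 * Real.pi * g s := by
  have h1 : Integrable (𝓕 g) := by
    have := (𝓕 (hc.toSchwartzMap hg)).integrable (μ := volume)
    rwa [SchwartzMap.fourier_coe] at this
  have h2 := hg.continuous.fourierInv_fourier_eq (hg.continuous.integrable_of_hasCompactSupport hc)
    h1
  have h3 := congrFun h2 s
  rw [Real.fourierInv_eq'] at h3
  rw [← h3]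
  have h4 := Measure.integral_comp_mul_left (fun v : ℝ =>
    Complex.exp (↑(2 * Real.pi * inner ℝ v s) * Complex.I) • 𝓕 g v) (2 * Real.pi)⁻¹
  rw [inv_inv, abs_of_pos (by positivity)] at h4
  have h5 (z : ℂ) : (2 * Real.pi : ℂ) * z = (2 * Real.pi : ℝ) • z := by
    rw [Complex.real_smul]; push_cast; rfl
  rw [h5, ← h4]
  congr 1 with σ
  rw [ftLine_eq, smul_eq_mul]
  congr 2
  have : (Real.pi : ℂ) ≠ 0 := by simp [Real.pi_ne_zero]
  simp
  field_simp

lemma ftLine_deriv {g : ℝ → ℂ} (hg : ContDiff ℝ ∞ g) (hc : HasCompactSupport g) (σ : ℝ) :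
    ftLine (deriv g) σ = Complex.I * σ * ftLine g σ := by
  rw [ftLine_eq, ftLine_eq, Real.fourier_deriv (hg.continuous.integrable_of_hasCompactSupport hc)
    (hg.differentiable (by simp))
    ((hg.continuous_deriv (by simp)).integrable_of_hasCompactSupport hc.deriv)]
  have : (Real.pi : ℂ) ≠ 0 := by simp [Real.pi_ne_zero]
  beta_reduce
  rw [smul_eq_mul]
  congr 1
  push_cast
  field_simp

lemma contDiff_deriv {g : ℝ → ℂ} (hg : ContDiff ℝ ∞ g) : ContDiff ℝ ∞ (deriv g) :=
  (contDiff_infty_iff_deriv.1 hg).2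

/-! ### The two-dimensional Fourier transform -/

lemma ft_eq (u : ℂ → ℂ) (ζ : ℂ) : ft u ζ = 𝓕 u ((2 * Real.pi)⁻¹ • ζ) := by
  rw [Real.fourier_eq', ft]
  congr 1 with x
  rw [smul_eq_mul, inner_smul_right]
  congr 2
  have : (Real.pi : ℂ) ≠ 0 := by simp [Real.pi_ne_zero]
  push_cast
  field_simp

lemma opOf_eq (a : ℂ → ℂ) (u : ℂ → ℂ) (x : ℂ) :
    opOf (fun _ ζ => a ζ) u x = 𝓕⁻ (fun w : ℂ => a ((2 * Real.pi) • w) * 𝓕 u w) x := by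
  rw [Real.fourierInv_eq', opOf]
  have h := Measure.integral_comp_smul (volume : Measure ℂ) (fun ζ : ℂ =>
    Complex.exp (Complex.I * (inner ℝ x ζ : ℝ)) * (a ζ * ft u ζ)) (2 * Real.pi)
  rw [Complex.finrank_real_complex, Complex.real_smul, abs_of_pos (by positivity)] at h
  push_cast at h
  rw [← h]
  congr 1 with w
  rw [ft_eq, smul_smul, inv_mul_cancel₀ (by positivity), one_smul, smul_eq_mul, inner_smul_right,
    real_inner_comm]
  congr 2
  push_cast
  ring

variable {U : Set ℂ} {u : ℂ → ℂ}

lemma IsTest.contDiff (h : IsTest U u) : ContDiff ℝ ∞ u := h.1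

lemma IsTest.hasCompactSupport (h : IsTest U u) : HasCompactSupport u := h.2.1

lemma IsTest.integrable (h : IsTest U u) : Integrable u :=
  h.contDiff.continuous.integrable_of_hasCompactSupport h.hasCompactSupport

lemma IsTest.ft_eq_schwartz (h : IsTest U u) (ζ : ℂ) :
    ft u ζ = 𝓕 (h.hasCompactSupport.toSchwartzMap h.contDiff) ((2 * Real.pi)⁻¹ • ζ) := by
  rw [ft_eq, SchwartzMap.fourier_coe]; rfl

lemma IsTest.continuous_ft (h : IsTest U u) : Continuous (ft u) := by
  have : ft u = fun ζ => 𝓕 (h.hasCompactSupport.toSchwartzMap h.contDiff) ((2 * Real.pi)⁻¹ • ζ) :=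
    funext h.ft_eq_schwartz
  rw [this]
  exact (SchwartzMap.continuous _).comp (continuous_const_smul _)

lemma IsTest.integrable_pow_mul_ft (h : IsTest U u) (n : ℕ) :
    Integrable (fun ζ : ℂ => (‖ζ‖ : ℂ) ^ n * ft u ζ) := by
  have h1 := ((𝓕 (h.hasCompactSupport.toSchwartzMap h.contDiff)).integrable_pow_mul volume n).comp_smul
    (R := (2 * Real.pi)⁻¹) (by positivity)
  refine (h1.const_mul ((2 * Real.pi) ^ n)).mono' ?_ (Eventually.of_forall fun ζ => ?_)
  · exact (Continuous.mul (by fun_prop) h.continuous_ft).aestronglyMeasurable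
  · rw [h.ft_eq_schwartz, norm_mul, norm_pow, Complex.norm_real, norm_norm, norm_smul, norm_inv,
      Real.norm_of_nonneg (by positivity : 0 ≤ 2 * Real.pi), mul_pow (2 * Real.pi)⁻¹, inv_pow]
    apply le_of_eq
    field_simp

lemma IsTest.integrable_fourier (h : IsTest U u) : Integrable (𝓕 u) := by
  have := (𝓕 (h.hasCompactSupport.toSchwartzMap h.contDiff)).integrable (μ := volume)
  rwa [SchwartzMap.fourier_coe] at this

lemma IsTest.opOf_one (h : IsTest U u) (x : ℂ) : opOf (fun _ _ => 1) u x = u x := by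
  rw [opOf_eq (fun _ => 1)]
  simp only [one_mul]
  exact congrFun (h.contDiff.continuous.fourierInv_fourier_eq h.integrable h.integrable_fourier) x

/-! ### Rotated Cartesian coordinates -/

/-- The measure-preserving coordinates `(s, r) ↦ e^{iθ} (s + i r)`. -/
def rotCoord (θ : ℝ) (p : ℝ × ℝ) : ℂ := Complex.exp (Complex.I * θ) * (p.1 + p.2 * Complex.I)

lemma measurePreserving_rotCoord (θ : ℝ) :
    MeasurePreserving (rotCoord θ) (volume.prod volume) volume := by
  have h1 : MeasurePreserving Complex.measurableEquivRealProd.symm (volume.prod volume) volume :=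
    Complex.volume_preserving_equiv_real_prod.symm
  have h2 : rotCoord θ = rotation (Circle.exp θ) ∘ Complex.measurableEquivRealProd.symm := by
    funext p
    simp [rotCoord, Circle.coe_exp, mul_comm Complex.I, Complex.mk_eq_add_mul_I]
  rw [h2]
  exact (rotation (Circle.exp θ)).measurePreserving.comp h1

lemma integrable_rotCoord {F : ℂ → ℂ} (hF : Integrable F) (θ : ℝ) :
    Integrable (fun p => F (rotCoord θ p)) (volume.prod volume) :=
  (measurePreserving_rotCoord θ).integrable_comp_of_integrable hF

lemma integral_rotCoord {F : ℂ → ℂ} (hF : Integrable F) (θ : ℝ) :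
    ∫ s : ℝ, ∫ r : ℝ, F (rotCoord θ (s, r)) = ∫ x, F x := by
  rw [← integral_prod (fun p => F (rotCoord θ p)) (integrable_rotCoord hF θ)]
  rw [← (measurePreserving_rotCoord θ).map_eq] at hF
  conv_rhs => rw [← (measurePreserving_rotCoord θ).map_eq]
  rw [integral_map (measurePreserving_rotCoord θ).aemeasurable hF.1]

lemma norm_rotCoord (θ : ℝ) (p : ℝ × ℝ) : ‖rotCoord θ p‖ = ‖(p.1 + p.2 * Complex.I : ℂ)‖ := by
  rw [rotCoord, norm_mul, mul_comm Complex.I, Complex.norm_exp_ofReal_mul_I, one_mul]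

lemma le_norm_rotCoord_fst (θ s r : ℝ) : |s| ≤ ‖rotCoord θ (s, r)‖ := by
  rw [norm_rotCoord]
  simpa using Complex.abs_re_le_norm (s + r * Complex.I : ℂ)

lemma le_norm_rotCoord_snd (θ s r : ℝ) : |r| ≤ ‖rotCoord θ (s, r)‖ := by
  rw [norm_rotCoord]
  simpa using Complex.abs_im_le_norm (s + r * Complex.I : ℂ)

lemma inner_rotCoord (θ s r : ℝ) :
    inner ℝ (rotCoord θ (s, r)) (Complex.exp (Complex.I * θ)) = s := by
  have h : Complex.exp (Complex.I * θ) * conj (Complex.exp (Complex.I * θ)) = 1 := by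
    rw [Complex.mul_conj', mul_comm Complex.I, Complex.norm_exp_ofReal_mul_I]; simp
  rw [Complex.inner, rotCoord, map_mul, ← mul_assoc, h]
  simp

lemma inner_mul_rotCoord (θ s r σ : ℝ) :
    inner ℝ (rotCoord θ (s, r)) (σ * Complex.exp (Complex.I * θ)) = σ * s := by
  rw [← Complex.real_smul, inner_smul_right, inner_rotCoord]

lemma contDiff_rotCoord : ContDiff ℝ ∞ (fun q : (ℝ × ℝ) × ℝ => rotCoord q.1.1 (q.1.2, q.2)) := by
  have h (f : (ℝ × ℝ) × ℝ → ℝ) (hf : ContDiff ℝ ∞ f) : ContDiff ℝ ∞ (fun q => (f q : ℂ)) :=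
    Complex.ofRealCLM.contDiff.comp hf
  unfold rotCoord
  have h1 := h (fun q => q.1.1) (by fun_prop)
  have h2 := h (fun q => q.1.2) (by fun_prop)
  have h3 := h (fun q => q.2) (by fun_prop)
  exact (contDiff_const.mul h1).cexp.mul (h2.add (h3.mul contDiff_const))

/-! ### The Radon transform -/

lemma radon_eq (u : ℂ → ℂ) (θ s : ℝ) : radon u θ s = ∫ r : ℝ, u (rotCoord θ (s, r)) := rfl

lemma IsTest.exists_radius (h : IsTest U u) : ∃ R : ℝ, 0 < R ∧ ∀ x, R < ‖x‖ → u x = 0 := by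
  obtain ⟨R, hR, hkR⟩ := h.hasCompactSupport.isCompact.isBounded.subset_closedBall_lt 0 (0 : ℂ)
  refine ⟨R, hR, fun x hx => image_eq_zero_of_notMem_tsupport fun hx' => ?_⟩
  have := hkR hx'
  simp only [Metric.mem_closedBall, dist_zero_right] at this
  linarith

/-- The parameter is meant for the family `F_x` with `x` on the circle; the common radius `R`
replaces each line by a fixed compact interval. -/
lemma contDiff_radon_param {P : Type*} [NormedAddCommGroup P] [NormedSpace ℝ P] {F : P → ℂ → ℂ}
    {R : ℝ} (hF : ContDiff ℝ ∞ (fun q : P × ℂ => F q.1 q.2)) (hR : ∀ p x, R < ‖x‖ → F p x = 0) :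
    ContDiff ℝ ∞ (fun q : P × ℝ × ℝ => radon (F q.1) q.2.1 q.2.2) := by
  have h1 : ContDiff ℝ ∞ (fun q : (P × ℝ × ℝ) × ℝ =>
      F q.1.1 (rotCoord q.1.2.1 (q.1.2.2, q.2))) := by
    have h2 : ContDiff ℝ ∞ (fun q : (P × ℝ × ℝ) × ℝ => (q.1.2, q.2)) := by fun_prop
    have h3 : ContDiff ℝ ∞ (fun q : (P × ℝ × ℝ) × ℝ => q.1.1) := by fun_prop
    exact hF.comp (h3.prodMk (contDiff_rotCoord.comp h2))
  refine (contDiff_congr fun q => ?_).1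
    (contDiff_setIntegral (μ := volume) (isCompact_Icc (a := -R) (b := R))
      (h := fun p r => F p.1 (rotCoord p.2.1 (p.2.2, r))) h1)
  rw [radon_eq]
  refine setIntegral_eq_integral_of_forall_compl_eq_zero fun r hr => hR _ _ ?_
  refine lt_of_lt_of_le ?_ (le_norm_rotCoord_snd _ _ _)
  contrapose! hr
  exact abs_le.1 hr

lemma IsTest.contDiff_radon (h : IsTest U u) :
    ContDiff ℝ ∞ (fun p : ℝ × ℝ => radon u p.1 p.2) := by
  obtain ⟨R, -, hR⟩ := h.exists_radius
  have h1 : ContDiff ℝ ∞ (fun q : ℝ × ℂ => u q.2) := h.contDiff.comp contDiff_snd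
  have h2 := contDiff_radon_param (F := fun _ : ℝ => u) h1 fun _ x hx => hR x hx
  exact h2.comp (contDiff_const (c := (0 : ℝ)).prodMk contDiff_id)

lemma IsTest.contDiff_radon_snd (h : IsTest U u) (θ : ℝ) : ContDiff ℝ ∞ (radon u θ) :=
  h.contDiff_radon.comp (contDiff_const.prodMk contDiff_id)

lemma radon_eq_zero {R : ℝ} (hR : ∀ x, R < ‖x‖ → u x = 0) {θ s : ℝ} (hs : R < |s|) :
    radon u θ s = 0 := by
  rw [radon_eq]
  refine integral_eq_zero_of_ae (Eventually.of_forall fun r => hR _ ?_)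
  exact hs.trans_le (le_norm_rotCoord_fst _ _ _)

lemma IsTest.hasCompactSupport_radon (h : IsTest U u) (θ : ℝ) : HasCompactSupport (radon u θ) := by
  obtain ⟨R, -, hR⟩ := h.exists_radius
  refine HasCompactSupport.intro (isCompact_Icc (a := -R) (b := R)) fun s hs => radon_eq_zero hR ?_
  contrapose! hs
  exact abs_le.1 hs

lemma radon_add_two_pi (u : ℂ → ℂ) (θ s : ℝ) : radon u (θ + 2 * Real.pi) s = radon u θ s := by
  have : Complex.exp (Complex.I * ((θ + 2 * Real.pi : ℝ) : ℂ)) = Complex.exp (Complex.I * θ) := by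
    push_cast
    rw [mul_add, show Complex.I * (2 * Real.pi) = 2 * Real.pi * Complex.I by ring,
      Complex.exp_periodic]
  simp only [radon, this]

/-- The Fourier slice theorem. -/
lemma IsTest.ftLine_radon (h : IsTest U u) (θ σ : ℝ) :
    ftLine (radon u θ) σ = ft u (σ * Complex.exp (Complex.I * θ)) := by
  have h1 : Integrable (fun x : ℂ => Complex.exp (-(Complex.I *
      (inner ℝ x (σ * Complex.exp (Complex.I * θ)) : ℝ))) * u x) := by
    refine Continuous.integrable_of_hasCompactSupport ?_ h.hasCompactSupport.mul_left
    have := h.contDiff.continuous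
    fun_prop
  rw [ft, ← integral_rotCoord h1 θ, ftLine]
  congr 1 with s
  rw [radon_eq, ← integral_const_mul]
  congr 1 with r
  rw [inner_mul_rotCoord]
  push_cast
  rw [mul_assoc]

/-! ### Partial derivatives and iterated integrals -/

lemma contDiff_deriv_snd {P : Type*} [NormedAddCommGroup P] [NormedSpace ℝ P] {h : P → ℝ → ℂ}
    (hh : ContDiff ℝ ∞ (fun q : P × ℝ => h q.1 q.2)) :
    ContDiff ℝ ∞ (fun q : P × ℝ => deriv (h q.1) q.2) := by
  have h1 : ContDiff ℝ ∞ (fderiv ℝ (fun q : P × ℝ => h q.1 q.2)) :=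
    hh.fderiv_right (m := ∞) (by simp)
  refine (contDiff_congr fun q => ?_).1 (h1.clm_apply (contDiff_const (c := ((0 : P), (1 : ℝ)))))
  have h2 := ((hh.differentiable (by simp)) q).hasFDerivAt
  have h3 : HasDerivAt (fun t : ℝ => (q.1, t)) ((0 : P), (1 : ℝ)) q.2 :=
    (hasDerivAt_const _ _).prodMk (hasDerivAt_id _)
  exact (h2.comp_hasDerivAt q.2 h3).deriv.symm

lemma integrable_restrict_prod {X Y : Type*} [TopologicalSpace X] [TopologicalSpace Y]
    [T2Space X] [T2Space Y]
    [MeasurableSpace X] [MeasurableSpace Y] [BorelSpace X] [BorelSpace Y]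
    [SecondCountableTopologyEither X Y]
    {μ : Measure X} {ν : Measure Y} [SFinite μ] [SFinite ν] [IsFiniteMeasureOnCompacts μ]
    [IsFiniteMeasureOnCompacts ν] {K : Set X} {L : Set Y} (hK : IsCompact K) (hL : IsCompact L)
    {F : X → Y → ℂ} (hF : Continuous (fun p : X × Y => F p.1 p.2))
    (h0 : ∀ x, ∀ y, y ∉ L → F x y = 0) :
    Integrable (fun p : X × Y => F p.1 p.2) ((μ.restrict K).prod ν) := by
  have h1 : IntegrableOn (fun p : X × Y => F p.1 p.2) (K ×ˢ L) (μ.prod ν) :=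
    hF.continuousOn.integrableOn_compact (hK.prod hL)
  rw [IntegrableOn, ← Measure.prod_restrict] at h1
  have h2 : (μ.restrict K).prod (ν.restrict L) = ((μ.restrict K).prod ν).restrict (univ ×ˢ L) := by
    rw [← Measure.prod_restrict, Measure.restrict_univ]
  rw [h2] at h1
  refine (integrableOn_iff_integrable_of_support_subset ?_).1 h1
  intro p hp
  refine ⟨mem_univ _, ?_⟩
  by_contra hy
  exact hp (h0 _ _ hy)

lemma intervalIntegral_integral_swap {Y : Type*} [TopologicalSpace Y] [T2Space Y]
    [MeasurableSpace Y] [BorelSpace Y] {ν : Measure Y} [SFinite ν]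
    [IsFiniteMeasureOnCompacts ν] {a b : ℝ} (hab : a ≤ b) {L : Set Y} (hL : IsCompact L)
    {F : ℝ → Y → ℂ} (hF : Continuous (fun p : ℝ × Y => F p.1 p.2))
    (h0 : ∀ x, ∀ y, y ∉ L → F x y = 0) :
    ∫ φ in a..b, ∫ y, F φ y ∂ν = ∫ y, (∫ φ in a..b, F φ y) ∂ν := by
  simp only [intervalIntegral.integral_of_le hab, ← integral_Icc_eq_integral_Ioc]
  exact integral_integral_swap
    (integrable_restrict_prod (μ := volume) isCompact_Icc hL hF h0)

lemma intervalIntegral_conj {a b : ℝ} (hab : a ≤ b) (f : ℝ → ℂ) :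
    ∫ φ in a..b, conj (f φ) = conj (∫ φ in a..b, f φ) := by
  simp only [intervalIntegral.integral_of_le hab, integral_conj]

/-! ### The averaged operator -/

lemma IsTest.T1a_eq (h : IsTest U u) (t φ : ℝ) :
    T1a u t φ = Complex.exp (-(Complex.I * φ)) *
      (-(1 / 2) * deriv (radon u (-φ)) (-t / 2)) := by
  have h1 : HasDerivAt (fun t' : ℝ => -t' / 2) (-(1 / 2) : ℝ) t := by
    have := ((hasDerivAt_id t).neg).div_const 2
    exact this.congr_deriv (by ring)
  have h2 := ((h.contDiff_radon_snd (-φ)).differentiable (by simp) (-t / 2)).hasDerivAt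
  have h3 : HasDerivAt (fun t' : ℝ => radon u (-φ) (-t' / 2))
      ((-(1 / 2) : ℝ) • deriv (radon u (-φ)) (-t / 2)) t :=
    HasDerivAt.scomp (h := fun t' : ℝ => -t' / 2) t h2 h1
  rw [T1a, h3.deriv, Complex.real_smul]
  push_cast
  rfl

lemma contDiff_ofReal_comp {E : Type*} [NormedAddCommGroup E] [NormedSpace ℝ E] {f : E → ℝ}
    (hf : ContDiff ℝ ∞ f) : ContDiff ℝ ∞ (fun x => (f x : ℂ)) :=
  Complex.ofRealCLM.contDiff.comp hf

lemma IsTest.isTestCyl_T1a (h : IsTest U u) : IsTestCyl (T1a u) := by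
  refine ⟨?_, fun t φ => ?_, ?_⟩
  · refine (contDiff_congr fun p : ℝ × ℝ => (h.T1a_eq p.1 p.2).symm).1 ?_
    have h1 := contDiff_deriv_snd h.contDiff_radon
    have h2 : ContDiff ℝ ∞ (fun p : ℝ × ℝ => (-p.2, -p.1 / 2)) := by fun_prop
    have h3 : ContDiff ℝ ∞ (fun p : ℝ × ℝ => (p.2 : ℂ)) := contDiff_ofReal_comp contDiff_snd
    exact ((contDiff_const.mul h3).neg.cexp).mul (contDiff_const.mul (h1.comp h2))
  · rw [h.T1a_eq, h.T1a_eq]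
    congr 1
    · push_cast
      rw [mul_add, neg_add, show -(Complex.I * (2 * Real.pi)) = -(2 * Real.pi * Complex.I) by ring,
        ← sub_eq_add_neg, Complex.exp_periodic.sub_eq]
    · congr 2
      funext s
      rw [← radon_add_two_pi u (-(φ + 2 * Real.pi))]
      congr 1
      ring
  · obtain ⟨R, hR, hu⟩ := h.exists_radius
    refine ⟨2 * R, fun t φ ht => ?_⟩
    have h1 : R < |-t / 2| := by
      rw [abs_div, abs_neg, abs_two]; linarith
    have h2 : radon u (-φ) =ᶠ[𝓝 (-t / 2)] fun _ => 0 := by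
      filter_upwards [(isOpen_lt continuous_const continuous_abs).mem_nhds h1] with s hs
      exact radon_eq_zero hu hs
    rw [h.T1a_eq, h2.deriv_eq]
    simp

/-- The explicit adjoint
`g ↦ -2κ ∫_0^{2π} e^{iφ} (∂_t g)(-2 n_{-φ} · x, φ) dφ` of `T₁ᵃ`. -/
def backProj (κ : ℝ) (g : ℝ → ℝ → ℂ) (x : ℂ) : ℂ :=
  -(2 * κ) * ∫ φ in (0 : ℝ)..(2 * Real.pi), Complex.exp (Complex.I * φ) *
    deriv (fun t => g t φ) (-2 * inner ℝ x (Complex.exp (Complex.I * (-φ : ℝ))))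

lemma IsTestCyl.contDiff_deriv {g : ℝ → ℝ → ℂ} (hg : IsTestCyl g) :
    ContDiff ℝ ∞ (fun q : ℝ × ℝ => deriv (fun t => g t q.1) q.2) :=
  contDiff_deriv_snd (h := fun φ t => g t φ) (hg.1.comp (contDiff_snd.prodMk contDiff_fst))

lemma contDiff_inner_exp : ContDiff ℝ ∞ (fun q : ℂ × ℝ =>
    inner ℝ q.1 (Complex.exp (Complex.I * (-q.2 : ℝ)))) := by
  have h : ContDiff ℝ ∞ (fun q : ℂ × ℝ => ((-q.2 : ℝ) : ℂ)) :=
    contDiff_ofReal_comp contDiff_snd.neg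
  exact contDiff_fst.inner ℝ (contDiff_const.mul h).cexp

lemma IsTestCyl.contDiff_backProj_integrand {g : ℝ → ℝ → ℂ} (hg : IsTestCyl g) :
    ContDiff ℝ ∞ (fun q : ℂ × ℝ => Complex.exp (Complex.I * q.2) *
      deriv (fun t => g t q.2) (-2 * inner ℝ q.1 (Complex.exp (Complex.I * (-q.2 : ℝ))))) := by
  have h : ContDiff ℝ ∞ (fun q : ℂ × ℝ => (q.2 : ℂ)) := contDiff_ofReal_comp contDiff_snd
  exact (contDiff_const.mul h).cexp.mul
    (hg.contDiff_deriv.comp (contDiff_snd.prodMk (contDiff_const.mul contDiff_inner_exp)))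

lemma IsTestCyl.contDiff_backProj {g : ℝ → ℝ → ℂ} (hg : IsTestCyl g) (κ : ℝ) :
    ContDiff ℝ ∞ (backProj κ g) :=
  contDiff_const.mul (contDiff_intervalIntegral (by positivity) hg.contDiff_backProj_integrand)

lemma IsTestCyl.hasCompactSupport {g : ℝ → ℝ → ℂ} (hg : IsTestCyl g) (φ : ℝ) :
    HasCompactSupport (fun t => g t φ) := by
  obtain ⟨M, hM⟩ := hg.2.2
  refine HasCompactSupport.intro (isCompact_Icc (a := -M) (b := M)) fun t ht => hM _ _ ?_
  contrapose! ht
  exact abs_le.1 ht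

lemma hasDerivAt_conj {f : ℝ → ℂ} {f' : ℂ} {x : ℝ} (h : HasDerivAt f f' x) :
    HasDerivAt (fun t => conj (f t)) (conj f') x :=
  (Complex.conjCLE.toContinuousLinearMap.hasFDerivAt (x := f x)).comp_hasDerivAt x h

/-- Integration by parts in `t` and rotated coordinates in the plane. -/
lemma IsTest.integral_T1a_mul (h : IsTest U u) {g : ℝ → ℝ → ℂ} (hg : IsTestCyl g) (φ : ℝ) :
    ∫ t : ℝ, T1a u t φ * conj (g t φ) = ∫ x : ℂ, -2 * (u x * conj (Complex.exp (Complex.I * φ) *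
      deriv (fun t => g t φ) (-2 * inner ℝ x (Complex.exp (Complex.I * (-φ : ℝ)))))) := by
  set A : ℝ → ℂ := fun t => radon u (-φ) (-t / 2) with hA
  have hA1 : ContDiff ℝ ∞ A := (h.contDiff_radon_snd (-φ)).comp (by fun_prop)
  have hA0 : HasCompactSupport A :=
    (h.hasCompactSupport_radon (-φ)).comp_homeomorph
      ((Homeomorph.neg ℝ).trans (Homeomorph.mulRight₀ (2 : ℝ)⁻¹ (by norm_num)))
  have hg1 : ContDiff ℝ ∞ (fun t => g t φ) := hg.1.comp (contDiff_id.prodMk contDiff_const)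
  have hparts : ∫ t : ℝ, A t * conj (deriv (fun t => g t φ) t) =
      -∫ t : ℝ, deriv A t * conj (g t φ) := by
    have c1 := hA1.continuous
    have c2 := hA1.continuous_deriv (by simp)
    have c3 := hg1.continuous
    have c4 := hg1.continuous_deriv (by simp)
    refine integral_mul_deriv_eq_deriv_mul_of_integrable (v := fun t => conj (g t φ))
      (fun t _ => (hA1.differentiable (by simp) t).hasDerivAt)
      (fun t _ => hasDerivAt_conj (hg1.differentiable (by simp) t).hasDerivAt) ?_ ?_ ?_
    · exact Continuous.integrable_of_hasCompactSupport (by fun_prop) hA0.mul_right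
    · exact Continuous.integrable_of_hasCompactSupport (by fun_prop) hA0.deriv.mul_right
    · exact Continuous.integrable_of_hasCompactSupport (by fun_prop) hA0.mul_right
  have hint : Integrable (fun x => u x * conj
      (deriv (fun t => g t φ) (-2 * inner ℝ x (Complex.exp (Complex.I * (-φ : ℝ)))))) := by
    have c1 := h.contDiff.continuous
    have c2 := hg1.continuous_deriv (by simp)
    exact Continuous.integrable_of_hasCompactSupport (by fun_prop) h.hasCompactSupport.mul_right
  have hsub : ∫ t : ℝ, A t * conj (deriv (fun t => g t φ) t) =
      2 * ∫ x : ℂ, u x * conj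
        (deriv (fun t => g t φ) (-2 * inner ℝ x (Complex.exp (Complex.I * (-φ : ℝ))))) := by
    -- Substituting `t = -2s` undoes the argument `-t/2`. Its Jacobian `2` and the sign from
    -- integration by parts make up the `-2` of the adjoint.
    have h1 := Measure.integral_comp_mul_left
      (fun t : ℝ => A t * conj (deriv (fun t => g t φ) t)) (-2)
    rw [show |(-2 : ℝ)⁻¹| = 2⁻¹ by rw [abs_inv]; norm_num, Complex.real_smul] at h1
    rw [← integral_rotCoord hint (-φ)]
    have h2 : ∫ t : ℝ, A t * conj (deriv (fun t => g t φ) t) =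
      2 * ∫ s : ℝ, A (-2 * s) * conj (deriv (fun t => g t φ) (-2 * s)) := by
      rw [h1]; push_cast; ring
    rw [h2]
    congr 2 with s
    simp only [inner_rotCoord]
    rw [integral_mul_const, ← radon_eq]
    congr 1
    simp only [hA]
    rw [show -(-2 * s) / 2 = s by ring]
  have hT : ∀ t, T1a u t φ * conj (g t φ) =
      Complex.exp (-(Complex.I * φ)) * (deriv A t * conj (g t φ)) := fun t => by
    rw [T1a, mul_assoc]
  have hexp : conj (Complex.exp (Complex.I * φ)) = Complex.exp (-(Complex.I * φ)) := by
    rw [← Complex.exp_conj]; simp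
  simp only [hT, map_mul, hexp]
  rw [integral_const_mul, integral_const_mul, neg_eq_iff_eq_neg.1 hparts.symm, hsub]
  simp only [mul_left_comm (u _)]
  rw [integral_const_mul]
  ring

lemma isAdjointT1a_backProj (κ : ℝ) : IsAdjointT1a κ (backProj κ) := by
  intro g hg
  refine ⟨hg.contDiff_backProj κ, fun ψ h => ?_⟩
  have hswap := intervalIntegral_integral_swap (ν := (volume : Measure ℂ)) (a := 0)
    (b := 2 * Real.pi) (by positivity) h.hasCompactSupport.isCompact
    (F := fun φ x => -2 * (ψ x * conj (Complex.exp (Complex.I * φ) *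
      deriv (fun t => g t φ) (-2 * inner ℝ x (Complex.exp (Complex.I * (-φ : ℝ)))))))
    ?_ fun φ x hx => by simp [image_eq_zero_of_notMem_tsupport hx]
  · rw [innerCyl]
    simp only [h.integral_T1a_mul hg]
    rw [hswap, ← integral_const_mul]
    congr 1 with x
    rw [intervalIntegral.integral_const_mul, intervalIntegral.integral_const_mul, backProj,
      map_mul, ← intervalIntegral_conj (by positivity)]
    have : conj (-(2 * κ : ℂ)) = -(2 * κ) := by
      rw [map_neg, map_mul, Complex.conj_ofReal, Complex.conj_ofNat]
    rw [this]
    ring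
  · have c1 := h.contDiff.continuous
    have c2 := hg.contDiff_backProj_integrand.continuous
    have c3 := c2.comp (continuous_swap (X := ℝ) (Y := ℂ))
    exact continuous_const.mul ((c1.comp continuous_snd).mul (Complex.continuous_conj.comp c3))

/-- Both adjoints pair equally with every test function, so they agree almost everywhere, hence
everywhere by continuity. This turns any abstract adjoint into the explicit one. -/
lemma IsAdjointT1a.eq_backProj {κ : ℝ} {S : (ℝ → ℝ → ℂ) → ℂ → ℂ} (hS : IsAdjointT1a κ S)
    {g : ℝ → ℝ → ℂ} (hg : IsTestCyl g) : S g = backProj κ g := by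
  obtain ⟨h1, h2⟩ := hS g hg
  obtain ⟨h3, h4⟩ := isAdjointT1a_backProj κ g hg
  have c1 := h1.continuous
  have c3 := h3.continuous
  have hc : Continuous (fun x => conj (S g x - backProj κ g x)) := by fun_prop
  have hae : ∀ᵐ x : ℂ, conj (S g x - backProj κ g x) = 0 := by
    refine ae_eq_zero_of_integral_contDiff_smul_eq_zero hc.locallyIntegrable fun w hw hwc => ?_
    have hψ : IsTest univ (fun x => (w x : ℂ)) :=
      ⟨contDiff_ofReal_comp hw, hwc.comp_left (g := ((↑) : ℝ → ℂ)) (by simp), subset_univ _⟩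
    have hi (f : ℂ → ℂ) (hf : Continuous f) : Integrable (fun x => (w x : ℂ) * conj (f x)) := by
      have := hψ.contDiff.continuous
      exact Continuous.integrable_of_hasCompactSupport (by fun_prop)
        hψ.hasCompactSupport.mul_right
    have := (h2 _ hψ).symm.trans (h4 _ hψ)
    rw [← sub_eq_zero, ← integral_sub (hi _ c1) (hi _ c3)] at this
    rw [← this]
    congr 1 with x
    rw [Complex.real_smul, map_sub, mul_sub]
  have := Measure.eq_of_ae_eq hae hc continuous_const
  funext x
  have hx := congrFun this x
  rwa [map_eq_zero, sub_eq_zero] at hx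

/-! ### The normal operator as a Fourier multiplier -/

/-- Supplies a majorant in the radial variable, uniform in the angle, for the polar coordinate
computation. -/
lemma IsTest.exists_decay_ft (h : IsTest U u) :
    ∃ C : ℝ, ∀ ζ, ‖ζ‖ ^ 2 * ‖ft u ζ‖ ≤ C * (1 + ‖ζ‖ ^ 2)⁻¹ := by
  obtain ⟨A, -, hA⟩ := (𝓕 (h.hasCompactSupport.toSchwartzMap h.contDiff)).decay 2 0
  obtain ⟨B, -, hB⟩ := (𝓕 (h.hasCompactSupport.toSchwartzMap h.contDiff)).decay 4 0
  refine ⟨(2 * Real.pi) ^ 2 * A + (2 * Real.pi) ^ 4 * B, fun ζ => ?_⟩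
  rw [← div_eq_mul_inv, le_div_iff₀ (by positivity)]
  have hA := hA ((2 * Real.pi)⁻¹ • ζ)
  have hB := hB ((2 * Real.pi)⁻¹ • ζ)
  rw [norm_iteratedFDeriv_zero, ← h.ft_eq_schwartz, norm_smul, norm_inv,
    Real.norm_of_nonneg (by positivity : 0 ≤ 2 * Real.pi), mul_pow, inv_pow, mul_assoc,
    inv_mul_le_iff₀ (by positivity)] at hA hB
  linarith

lemma deriv_T1a (h : IsTest U u) (t φ : ℝ) :
    deriv (fun t => T1a u t φ) t =
      Complex.exp (-(Complex.I * φ)) * (1 / 4 * deriv (deriv (radon u (-φ))) (-t / 2)) := by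
  have h1 : HasDerivAt (fun t' : ℝ => -t' / 2) (-(1 / 2) : ℝ) t := by
    have := ((hasDerivAt_id t).neg).div_const 2
    exact this.congr_deriv (by ring)
  have h2 := ((contDiff_deriv (h.contDiff_radon_snd (-φ))).differentiable
    (by simp) (-t / 2)).hasDerivAt
  have h3 := HasDerivAt.scomp (h := fun t' : ℝ => -t' / 2) t h2 h1
  simp only [h.T1a_eq]
  have h4 := (h3.const_mul (-(1 / 2) : ℂ)).const_mul (Complex.exp (-(Complex.I * φ)))
  refine h4.deriv.trans ?_
  rw [Complex.real_smul]
  push_cast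
  ring

lemma periodic_exp_mul_I (θ : ℝ) : Complex.exp (Complex.I * ((θ + 2 * Real.pi : ℝ) : ℂ)) =
    Complex.exp (Complex.I * θ) := by
  push_cast
  rw [mul_add, show Complex.I * (2 * Real.pi) = 2 * Real.pi * Complex.I by ring,
    Complex.exp_periodic]

/-- The two `t`-derivatives contribute `1/4`, and `-2κ/4 = -κ/2`. Periodicity moves the angle to
`(-π, π)`, the range of polar coordinates. -/
lemma backProj_T1a (h : IsTest U u) (κ : ℝ) (x : ℂ) :
    backProj κ (T1a u) x = -(κ / 2) * ∫ θ in (-Real.pi)..Real.pi,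
      deriv (deriv (radon u θ)) (inner ℝ x (Complex.exp (Complex.I * θ))) := by
  set H : ℝ → ℂ := fun θ =>
    deriv (deriv (radon u θ)) (inner ℝ x (Complex.exp (Complex.I * θ))) with hH
  have hper : Function.Periodic H (2 * Real.pi) := fun θ => by
    simp only [hH, periodic_exp_mul_I]
    congr 2
    funext s
    exact radon_add_two_pi u θ s
  have h1 : ∫ θ in (-Real.pi)..Real.pi, H θ = ∫ φ in (0 : ℝ)..(2 * Real.pi), H (-φ) := by
    rw [intervalIntegral.integral_comp_neg]
    have := hper.intervalIntegral_add_eq (-Real.pi) (-(2 * Real.pi))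
    convert this using 2 <;> ring
  have h2 : ∀ φ : ℝ, Complex.exp (Complex.I * φ) * deriv (fun t => T1a u t φ)
      (-2 * inner ℝ x (Complex.exp (Complex.I * (-φ : ℝ)))) = 1 / 4 * H (-φ) := fun φ => by
    rw [deriv_T1a h, ← mul_assoc, ← Complex.exp_add, add_neg_cancel, Complex.exp_zero, one_mul]
    simp only [hH]
    congr 3
    ring
  rw [backProj, h1]
  simp only [h2]
  rw [intervalIntegral.integral_const_mul]
  ring

/-- Fourier inversion on the line combined with the slice theorem; the sign is `i²`. -/
lemma deriv_deriv_radon (h : IsTest U u) (θ s : ℝ) :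
    deriv (deriv (radon u θ)) s = -(2 * Real.pi : ℂ)⁻¹ * ∫ σ : ℝ,
      Complex.exp (Complex.I * σ * s) * ((σ : ℂ) ^ 2 * ft u (σ * Complex.exp (Complex.I * θ))) := by
  have g1 := h.contDiff_radon_snd θ
  have g2 := h.hasCompactSupport_radon θ
  have h1 := integral_exp_mul_ftLine (contDiff_deriv (contDiff_deriv g1)) g2.deriv.deriv s
  have h2 : ∀ σ : ℝ, Complex.exp (Complex.I * σ * s) * ftLine (deriv (deriv (radon u θ))) σ =
      -1 * (Complex.exp (Complex.I * σ * s) *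
        ((σ : ℂ) ^ 2 * ft u (σ * Complex.exp (Complex.I * θ)))) := fun σ => by
    rw [ftLine_deriv (contDiff_deriv g1) g2.deriv, ftLine_deriv g1 g2, h.ftLine_radon]
    linear_combination (σ : ℂ) ^ 2 * (Complex.exp (Complex.I * σ * s) *
      ft u (σ * Complex.exp (Complex.I * θ))) * Complex.I_sq
  simp only [h2] at h1
  rw [integral_const_mul] at h1
  have : (Real.pi : ℂ) ≠ 0 := by simp [Real.pi_ne_zero]
  rw [eq_comm, neg_mul, neg_eq_iff_eq_neg, inv_mul_eq_iff_eq_mul₀ (by simp [this])]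
  linear_combination -h1

lemma integral_polar {F : ℂ → ℂ} :
    ∫ ζ, F ζ = ∫ p in Ioi (0 : ℝ) ×ˢ Ioo (-Real.pi) Real.pi,
      p.1 * F (p.1 * Complex.exp (Complex.I * p.2)) := by
  rw [← Complex.integral_comp_polarCoord_symm, polarCoord_target]
  refine setIntegral_congr_fun (measurableSet_Ioi.prod measurableSet_Ioo) fun p _ => ?_
  simp only [Complex.real_smul]
  rw [Complex.polarCoord_symm_apply, mul_comm Complex.I, Complex.exp_mul_I]
  simp

/-- The filtered back-projection formula: `(T₁ᵃ)^* T₁ᵃ = 2πκ |D|`. -/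
theorem backProj_T1a_eq_opOf (h : IsTest U u) (κ : ℝ) (x : ℂ) :
    backProj κ (T1a u) x = opOf (fun _ ζ => ((2 * Real.pi * κ * ‖ζ‖ : ℝ) : ℂ)) u x := by
  set E : ℝ → ℝ → ℂ := fun θ σ =>
    Complex.exp (Complex.I * σ * (inner ℝ x (Complex.exp (Complex.I * θ)) : ℝ)) *
      ((σ : ℂ) ^ 2 * ft u (σ * Complex.exp (Complex.I * θ))) with hE
  have hcont : Continuous (fun p : ℝ × ℝ => E p.1 p.2) := by
    have := h.continuous_ft
    simp only [hE]
    fun_prop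
  -- `(-σ, θ)` and `(σ, θ + π)` name the same frequency.
  have hneg : ∀ θ σ, E θ (-σ) = E (θ + Real.pi) σ := fun θ σ => by
    have : Complex.exp (Complex.I * ((θ + Real.pi : ℝ) : ℂ)) = -Complex.exp (Complex.I * θ) := by
      push_cast
      rw [mul_add, mul_comm _ (Real.pi : ℂ), Complex.exp_add, Complex.exp_pi_mul_I]
      ring
    simp only [hE, this, inner_neg_right, Complex.ofReal_neg, neg_mul, mul_neg, neg_sq]
  have hper : ∀ σ, Function.Periodic (fun θ => E θ σ) (2 * Real.pi) := fun σ θ => by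
    simp only [hE, periodic_exp_mul_I]
  obtain ⟨C, hC⟩ := h.exists_decay_ft
  have hbound : ∀ θ σ, ‖E θ σ‖ ≤ C * (1 + σ ^ 2)⁻¹ := fun θ σ => by
    have hn : ‖(σ : ℂ) * Complex.exp (Complex.I * θ)‖ = |σ| := by
      rw [norm_mul, mul_comm Complex.I, Complex.norm_exp_ofReal_mul_I, Complex.norm_real, mul_one,
        Real.norm_eq_abs]
    have := hC (σ * Complex.exp (Complex.I * θ))
    rw [hn, sq_abs] at this
    refine le_trans (le_of_eq ?_) this
    simp only [hE]
    rw [norm_mul, norm_mul, norm_pow, Complex.norm_real, Real.norm_eq_abs, sq_abs,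
      show Complex.I * σ * (inner ℝ x (Complex.exp (Complex.I * θ)) : ℝ) =
        ((σ * inner ℝ x (Complex.exp (Complex.I * θ)) : ℝ) : ℂ) * Complex.I by push_cast; ring,
      Complex.norm_exp_ofReal_mul_I, one_mul]
  have hintE : ∀ θ, Integrable (E θ) := fun θ =>
    (integrable_inv_one_add_sq.const_mul C).mono'
      (hcont.comp (continuous_const.prodMk continuous_id)).aestronglyMeasurable
      (Eventually.of_forall (hbound θ))
  have hJc : Continuous (fun θ => ∫ σ in Ioi (0 : ℝ), E θ σ) :=
    continuous_of_dominated (bound := fun σ => C * (1 + σ ^ 2)⁻¹)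
      (fun θ => (hintE θ).restrict.1) (fun θ => Eventually.of_forall (hbound θ))
      (integrable_inv_one_add_sq.const_mul C).restrict
      (Eventually.of_forall fun σ => hcont.comp (continuous_id.prodMk continuous_const))
  set J : ℝ → ℂ := fun θ => ∫ σ in Ioi (0 : ℝ), E θ σ with hJ
  have hJper : Function.Periodic J (2 * Real.pi) := fun θ => by
    simp only [hJ, fun σ => hper σ θ]
  have hsplit : ∀ θ, ∫ σ, E θ σ = J θ + J (θ + Real.pi) := fun θ => by
    rw [← integral_add_compl measurableSet_Ioi (hintE θ), compl_Ioi, add_right_inj]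
    simp only [hJ, ← hneg]
    rw [integral_comp_neg_Ioi, neg_zero]
  -- The factor `2` counts the two half-lines of each line through the origin.
  have hsum : ∫ θ in (-Real.pi)..Real.pi, ∫ σ, E θ σ = 2 * ∫ θ in (-Real.pi)..Real.pi, J θ := by
    simp only [hsplit]
    rw [intervalIntegral.integral_add (hJc.intervalIntegrable _ _)
      (Continuous.intervalIntegrable (by fun_prop) _ _),
      intervalIntegral.integral_comp_add_right]
    have := hJper.intervalIntegral_add_eq (-Real.pi) 0
    rw [show -Real.pi + 2 * Real.pi = Real.pi by ring, zero_add] at this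
    rw [neg_add_cancel, ← two_mul Real.pi, ← this]
    ring
  -- One power of `σ` in `σ²` is the polar Jacobian, the other is `|ζ|`.
  have hpolar : ∫ ζ : ℂ, Complex.exp (Complex.I * (inner ℝ x ζ : ℝ)) * ((‖ζ‖ : ℂ) * ft u ζ) =
      ∫ θ in (-Real.pi)..Real.pi, J θ := by
    have h1 : ∀ p ∈ Ioi (0 : ℝ) ×ˢ Ioo (-Real.pi) Real.pi,
        (p.1 : ℂ) * (Complex.exp (Complex.I *
          (inner ℝ x (p.1 * Complex.exp (Complex.I * p.2) : ℂ) : ℝ)) *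
          ((‖p.1 * Complex.exp (Complex.I * p.2)‖ : ℂ) *
            ft u (p.1 * Complex.exp (Complex.I * p.2)))) = E p.2 p.1 := fun p hp => by
      have hσ : (0 : ℝ) < p.1 := hp.1
      simp only [hE]
      rw [← Complex.real_smul (x := p.1) (z := Complex.exp _), inner_smul_right, norm_smul, mul_comm Complex.I (p.2 : ℂ),
        Complex.norm_exp_ofReal_mul_I, Real.norm_of_nonneg hσ.le]
      push_cast
      ring_nf
    rw [integral_polar, setIntegral_congr_fun (measurableSet_Ioi.prod measurableSet_Ioo) h1,
      Measure.volume_eq_prod]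
    refine (setIntegral_prod_swap (μ := volume) (ν := volume) (Ioo (-Real.pi) Real.pi)
      (Ioi (0 : ℝ)) (fun p : ℝ × ℝ => E p.1 p.2)).trans ?_
    rw [setIntegral_prod, intervalIntegral.integral_of_le (by linarith [Real.pi_pos]),
      integral_Ioc_eq_integral_Ioo]
    rw [IntegrableOn, ← Measure.prod_restrict]
    exact ((integrable_inv_one_add_sq.const_mul C).restrict.comp_snd _).mono'
      hcont.aestronglyMeasurable (Eventually.of_forall fun p => hbound p.1 p.2)
  rw [backProj_T1a h]
  simp only [deriv_deriv_radon h]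
  rw [intervalIntegral.integral_const_mul, hsum, ← hpolar, opOf]
  have h5 : ∀ ζ : ℂ, Complex.exp (Complex.I * (inner ℝ x ζ : ℝ)) *
      (((2 * Real.pi * κ * ‖ζ‖ : ℝ) : ℂ) * ft u ζ) = (2 * Real.pi * κ) *
      (Complex.exp (Complex.I * (inner ℝ x ζ : ℝ)) * ((‖ζ‖ : ℂ) * ft u ζ)) := fun ζ => by
    push_cast; ring
  simp only [h5]
  rw [integral_const_mul]
  have : (Real.pi : ℂ) ≠ 0 := by simp [Real.pi_ne_zero]
  field_simp

/-! ### Integrability of `|D| u` -/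

/-- The weight `min(1, |y|²) / |y|³`. -/
def weight (y : ℂ) : ℝ := min 1 (‖y‖ ^ 2) * (‖y‖ ^ 3)⁻¹

lemma weight_nonneg (y : ℂ) : 0 ≤ weight y :=
  mul_nonneg (le_min zero_le_one (by positivity)) (by positivity)

/-- The radial density is `r · min(1, r²)/r³`, bounded near `0` and equal to `r⁻²` at infinity, so
`2/(1 + r²)` dominates it. -/
lemma integrable_weight : Integrable weight := by
  refine (integrable_fun_norm_addHaar (E := ℂ) volume
    (f := fun r => min 1 (r ^ 2) * (r ^ 3)⁻¹)).2 ?_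
  rw [Complex.finrank_real_complex]
  refine (integrable_inv_one_add_sq.const_mul 2).integrableOn.mono' ?_ ?_
  · exact Measurable.aestronglyMeasurable (by fun_prop)
  · refine (ae_restrict_iff' measurableSet_Ioi).2 (Eventually.of_forall fun r hr => ?_)
    have hr : 0 < r := hr
    have h0 : 0 ≤ min 1 (r ^ 2) := le_min zero_le_one (by positivity)
    rw [smul_eq_mul, Real.norm_of_nonneg (by positivity), ← div_eq_mul_inv, ← div_eq_mul_inv,
      ← mul_div_assoc, div_le_div_iff₀ (by positivity) (by positivity)]
    have h1 := min_le_left 1 (r ^ 2)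
    have h2 := min_le_right 1 (r ^ 2)
    have h3 : min 1 (r ^ 2) * (1 + r ^ 2) ≤ 2 * r ^ 2 := by nlinarith
    have := mul_le_mul_of_nonneg_left h3 hr.le
    calc _ = r * (min 1 (r ^ 2) * (1 + r ^ 2)) := by ring
      _ ≤ r * (2 * r ^ 2) := this
      _ = _ := by ring

/-- The derivative of `t ↦ u(x + ty) + u(x - ty)` compares `du` at two points `2t|y|` apart, and
`du` is Lipschitz; the mean value inequality on `[0, 1]` concludes. -/
lemma IsTest.exists_second_difference_le (h : IsTest U u) :
    ∃ M : ℝ, 0 ≤ M ∧ ∀ x y, ‖2 * u x - u (x + y) - u (x - y)‖ ≤ M * ‖y‖ ^ 2 := by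
  have h1 : ContDiff ℝ ∞ (fderiv ℝ u) := h.contDiff.fderiv_right (by simp)
  obtain ⟨C, hC⟩ := ContDiff.lipschitzWith_of_hasCompactSupport
    (h.hasCompactSupport.fderiv (𝕜 := ℝ)) h1 (by simp)
  refine ⟨2 * C, by positivity, fun x y => ?_⟩
  have hd (w : ℂ) (t : ℝ) : HasDerivAt (fun t : ℝ => u (x + t • w)) (fderiv ℝ u (x + t • w) w) t := by
    have e1 : HasDerivAt (fun t : ℝ => x + t • w) w t := by
      simpa using ((hasDerivAt_id t).smul_const w).const_add x
    exact ((h.contDiff.differentiable (by simp) (x + t • w)).hasFDerivAt).comp_hasDerivAt t e1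
  have key := norm_image_sub_le_of_norm_deriv_le_segment_01' (C := 2 * C * ‖y‖ ^ 2)
    (f := fun t : ℝ => u (x + t • y) + u (x + t • -y))
    (f' := fun t => fderiv ℝ u (x + t • y) y + fderiv ℝ u (x + t • -y) (-y))
    (fun t _ => ((hd y t).add (hd (-y) t)).hasDerivWithinAt) fun t ht => by
      rw [map_neg, ← sub_eq_add_neg, ← sub_apply]
      refine (ContinuousLinearMap.le_opNorm _ _).trans ?_
      have e2 := hC.dist_le_mul (x + t • y) (x + t • -y)
      rw [dist_eq_norm, dist_eq_norm, show x + t • y - (x + t • -y) = (2 * t) • y by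
        rw [smul_neg, mul_smul, two_smul]; abel, norm_smul, Real.norm_of_nonneg (by linarith [ht.1])]
        at e2
      have e3 : (C : ℝ) * (2 * t * ‖y‖) ≤ C * (2 * ‖y‖) := by
        have := ht.2.le
        gcongr
        linarith
      calc _ ≤ C * (2 * ‖y‖) * ‖y‖ := by gcongr; exact e2.trans e3
        _ = _ := by ring
  simp only [one_smul, zero_smul, add_zero, ← sub_eq_add_neg] at key
  rw [← norm_neg]
  refine le_trans (le_of_eq ?_) key
  congr 1
  ring

/-- `(2 u(x) - u(x + y) - u(x - y)) / |y|³`. -/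
def diffQuot (u : ℂ → ℂ) (x y : ℂ) : ℂ :=
  ((‖y‖ ^ 3)⁻¹ : ℝ) * (2 * u x - u (x + y) - u (x - y))

/-- For `|y| ≤ 1` the second difference is `O(|y|²)` and vanishes unless `|x| ≤ R + 1`. For `|y| >
1` the triangle inequality leaves one product and two convolution integrands of `L¹` functions. -/
lemma IsTest.integrable_diffQuot (h : IsTest U u) :
    Integrable (fun p : ℂ × ℂ => diffQuot u p.1 p.2) (volume.prod volume) := by
  obtain ⟨M, hM0, hM⟩ := h.exists_second_difference_le
  obtain ⟨R, hR, hu⟩ := h.exists_radius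
  have hc := h.contDiff.continuous
  set B : ℂ → ℝ := (Metric.closedBall (0 : ℂ) (R + 1)).indicator fun _ => M with hB
  have hBi : Integrable B := (integrable_indicator_iff Metric.isClosed_closedBall.measurableSet).2
    (integrableOn_const (isCompact_closedBall _ _).measure_lt_top.ne)
  have i1 : Integrable (fun p : ℂ × ℂ => B p.1 * weight p.2) (volume.prod volume) :=
    hBi.mul_prod integrable_weight
  have i2 : Integrable (fun p : ℂ × ℂ => 2 * ‖u p.1‖ * weight p.2) (volume.prod volume) :=
    (h.integrable.norm.const_mul 2).mul_prod integrable_weight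
  have i3 : Integrable (fun p : ℂ × ℂ => weight p.2 * ‖u (p.1 - p.2)‖) (volume.prod volume) :=
    integrable_weight.convolution_integrand (ContinuousLinearMap.mul ℝ ℝ) h.integrable.norm
  have i4 : Integrable (fun p : ℂ × ℂ => weight p.2 * ‖u (p.1 + p.2)‖) (volume.prod volume) := by
    have := ((MeasurePreserving.id (volume : Measure ℂ)).prod
      (Measure.measurePreserving_neg (volume : Measure ℂ))).integrable_comp_of_integrable i3
    simpa [Function.comp_def, weight] using this
  refine (((i1.add i2).add i3).add i4).mono' ?_ (Eventually.of_forall fun p => ?_)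
  · unfold diffQuot
    refine Measurable.aestronglyMeasurable ?_
    fun_prop
  · obtain ⟨x, y⟩ := p
    simp only [Pi.add_apply]
    rw [diffQuot, norm_mul, Complex.norm_real, Real.norm_of_nonneg (by positivity)]
    have hw := weight_nonneg y
    have hBx : 0 ≤ B x := indicator_nonneg (fun _ _ => hM0) _
    by_cases hy : ‖y‖ ≤ 1
    · have hmin : min 1 (‖y‖ ^ 2) = ‖y‖ ^ 2 := min_eq_right (pow_le_one₀ (norm_nonneg _) hy)
      have : (‖y‖ ^ 3)⁻¹ * ‖2 * u x - u (x + y) - u (x - y)‖ ≤ B x * weight y := by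
        by_cases hx : x ∈ Metric.closedBall (0 : ℂ) (R + 1)
        · rw [hB, indicator_of_mem hx, weight, hmin]
          calc _ ≤ (‖y‖ ^ 3)⁻¹ * (M * ‖y‖ ^ 2) := by gcongr; exact hM x y
            _ = _ := by ring
        · rw [mem_closedBall_zero_iff, not_le] at hx
          have a1 := norm_sub_le (x + y) y
          have a2 := norm_add_le (x - y) y
          rw [add_sub_cancel_right] at a1
          rw [sub_add_cancel] at a2
          rw [hu x (by linarith), hu (x + y) (by linarith), hu (x - y) (by linarith)]
          simp only [mul_zero, sub_zero, norm_zero]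
          positivity
      have : 0 ≤ 2 * ‖u x‖ * weight y + weight y * ‖u (x - y)‖ + weight y * ‖u (x + y)‖ := by
        positivity
      linarith
    · have hmin : weight y = (‖y‖ ^ 3)⁻¹ := by
        rw [weight, min_eq_left (one_le_pow₀ (not_le.1 hy).le), one_mul]
      have : ‖2 * u x - u (x + y) - u (x - y)‖ ≤ 2 * ‖u x‖ + ‖u (x + y)‖ + ‖u (x - y)‖ := by
        refine (norm_sub_le _ _).trans ?_
        gcongr
        refine (norm_sub_le _ _).trans ?_
        simp
      have h5 := mul_le_mul_of_nonneg_left this hw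
      rw [← hmin]
      have : 0 ≤ B x * weight y := by positivity
      linarith

/-- The symbol of the second difference weighted by `|y|⁻³`. -/
def diffSymbol (ζ y : ℂ) : ℝ := (‖y‖ ^ 3)⁻¹ * (2 - 2 * Real.cos (inner ℝ y ζ))

lemma diffSymbol_nonneg (ζ y : ℂ) : 0 ≤ diffSymbol ζ y := by
  have := Real.cos_le_one (inner ℝ y ζ)
  exact mul_nonneg (by positivity) (by linarith)

/-- `2 - 2 cos` is at most `4` and at most the square of its argument. -/
lemma diffSymbol_le (ζ y : ℂ) : diffSymbol ζ y ≤ (4 + ‖ζ‖ ^ 2) * weight y := by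
  have h1 := Real.neg_one_le_cos (inner ℝ y ζ)
  have h2 := Real.one_sub_sq_div_two_le_cos (x := inner ℝ y ζ)
  have h3 : (inner ℝ y ζ) ^ 2 ≤ ‖y‖ ^ 2 * ‖ζ‖ ^ 2 := by
    rw [← mul_pow, ← sq_abs]
    gcongr
    exact abs_real_inner_le_norm y ζ
  rw [diffSymbol, weight, ← mul_assoc, mul_comm]
  gcongr
  rcases le_total 1 (‖y‖ ^ 2) with hy | hy
  · rw [min_eq_left hy]; nlinarith [sq_nonneg ‖ζ‖]
  · rw [min_eq_right hy]; nlinarith [sq_nonneg ‖y‖]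

lemma measurable_diffSymbol : Measurable (fun p : ℂ × ℂ => diffSymbol p.1 p.2) := by
  unfold diffSymbol
  have : Measurable (fun p : ℂ × ℂ => inner ℝ p.2 p.1) := by
    exact Continuous.measurable (by fun_prop)
  fun_prop

/-- The constant in `∫ |y|⁻³ (2 - 2 cos (y · ζ)) dy = C |ζ|`. -/
def diffConst : ℝ := ∫ y, diffSymbol 1 y

lemma integrable_diffSymbol (ζ : ℂ) : Integrable (diffSymbol ζ) := by
  refine (integrable_weight.const_mul (4 + ‖ζ‖ ^ 2)).mono' ?_ (Eventually.of_forall fun y => ?_)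
  · exact (measurable_diffSymbol.comp (measurable_const.prodMk measurable_id)).aestronglyMeasurable
  · rw [Real.norm_of_nonneg (diffSymbol_nonneg _ _)]
    exact diffSymbol_le ζ y

/-- Near `y = 1` the phase `Re y` lies strictly between `0` and `π`, so the integrand is positive
there. Positivity allows division by the constant later. -/
lemma diffConst_pos : 0 < diffConst := by
  rw [diffConst, integral_pos_iff_support_of_nonneg (diffSymbol_nonneg 1) (integrable_diffSymbol 1)]
  refine lt_of_lt_of_le (Metric.measure_ball_pos volume (1 : ℂ) (by norm_num : (0 : ℝ) < 1 / 2))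
    (measure_mono fun y hy => ?_)
  rw [mem_ball_iff_norm] at hy
  have h1 := (Complex.abs_re_le_norm (y - 1)).trans_lt hy
  rw [Complex.sub_re, Complex.one_re, abs_lt] at h1
  have h2 : inner ℝ y 1 = y.re := by simp [Complex.inner]
  have h3 : y ≠ 0 := by rintro rfl; norm_num at h1
  have h4 : Real.cos y.re < 1 := by
    rw [← Real.cos_zero]
    exact Real.cos_lt_cos_of_nonneg_of_le_pi le_rfl (by linarith [Real.pi_gt_three]) (by linarith)
  rw [Function.mem_support, diffSymbol, h2]
  have : 0 < ‖y‖ := norm_pos_iff.2 h3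
  refine (mul_pos (by positivity) (by linarith)).ne'

/-- Rotate `ζ` to the positive axis and rescale `y` by `1/r`, `r = |ζ|`: the kernel gives `r³`, the
Jacobian takes `r²`, and one factor `r` remains. -/
lemma integral_diffSymbol (ζ : ℂ) : ∫ y, diffSymbol ζ y = diffConst * ‖ζ‖ := by
  rcases eq_or_ne ζ 0 with rfl | hζ
  · simp [diffSymbol]
  set r := ‖ζ‖ with hr
  have hr0 : 0 < r := norm_pos_iff.2 hζ
  set θ := Complex.arg ζ with hθ
  have hpol : ζ = r • Complex.exp (Complex.I * θ) := by
    rw [Complex.real_smul, mul_comm Complex.I, hr, hθ, Complex.norm_mul_exp_arg_mul_I]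
  have h1 := Measure.integral_comp_smul (volume : Measure ℂ) (diffSymbol ζ) r⁻¹
  have h2 := ((rotation (Circle.exp θ)).measurePreserving).integral_comp'
    (f := (rotation (Circle.exp θ)).toHomeomorph.toMeasurableEquiv)
    (fun y => diffSymbol ζ (r⁻¹ • y))
  have h3 : ∀ y : ℂ, diffSymbol ζ (r⁻¹ • rotation (Circle.exp θ) y) = r ^ 3 * diffSymbol 1 y := by
    intro y
    have e1 : inner ℝ (r⁻¹ • rotation (Circle.exp θ) y) ζ = inner ℝ y 1 := by
      rw [hpol, real_inner_smul_left, real_inner_smul_right, ← mul_assoc, inv_mul_cancel₀ hr0.ne',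
        one_mul]
      have : Complex.exp (Complex.I * θ) = rotation (Circle.exp θ) 1 := by
        simp [rotation_apply, Circle.coe_exp, mul_comm]
      rw [this, LinearIsometryEquiv.inner_map_map]
    rw [diffSymbol, e1, norm_smul, LinearIsometryEquiv.norm_map, diffSymbol, norm_inv,
      Real.norm_of_nonneg hr0.le, mul_pow, mul_inv, inv_pow, inv_inv, mul_assoc]
  rw [Complex.finrank_real_complex, ← h2] at h1
  have h4 : ∫ y : ℂ, diffSymbol ζ (r⁻¹ • rotation (Circle.exp θ) y) = r ^ 3 * diffConst := by
    simp only [h3]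
    rw [integral_const_mul, diffConst]
  have h5 := h4.symm.trans h1
  rw [inv_pow, inv_inv, abs_of_pos (by positivity), smul_eq_mul] at h5
  have : r ^ 2 ≠ 0 := by positivity
  apply mul_left_cancel₀ this
  rw [← h5]
  ring

lemma norm_exp_I_mul (a : ℝ) : ‖Complex.exp (Complex.I * a)‖ = 1 := by
  rw [mul_comm, Complex.norm_exp_ofReal_mul_I]

/-- Fourier inversion at `x` and `x ± y`, with `2 - e^{iy·ζ} - e^{-iy·ζ} = 2 - 2 cos(y·ζ)`. -/
lemma IsTest.diffQuot_eq (h : IsTest U u) (x y : ℂ) :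
    diffQuot u x y = ((2 * Real.pi : ℂ) ^ 2)⁻¹ * ∫ ζ : ℂ,
      Complex.exp (Complex.I * (inner ℝ x ζ : ℝ)) * ((diffSymbol ζ y : ℂ) * ft u ζ) := by
  have hi (z : ℂ) : Integrable (fun ζ : ℂ => Complex.exp (Complex.I * (inner ℝ z ζ : ℝ)) *
      (1 * ft u ζ)) := by
    have h1 := h.integrable_pow_mul_ft 0
    simp only [pow_zero] at h1
    have := h.continuous_ft
    refine h1.norm.mono' (Continuous.aestronglyMeasurable (by fun_prop))
      (Eventually.of_forall fun ζ => ?_)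
    rw [norm_mul, norm_exp_I_mul, one_mul]
  have hi2 : Integrable (fun ζ : ℂ =>
      2 * (Complex.exp (Complex.I * (inner ℝ x ζ : ℝ)) * (1 * ft u ζ)) -
        Complex.exp (Complex.I * (inner ℝ (x + y) ζ : ℝ)) * (1 * ft u ζ)) :=
    ((hi x).const_mul 2).sub (hi (x + y))
  rw [diffQuot, ← h.opOf_one x, ← h.opOf_one (x + y), ← h.opOf_one (x - y), opOf, opOf, opOf,
    mul_left_comm 2, ← mul_sub, ← mul_sub, ← integral_const_mul, ← integral_sub ((hi _).const_mul 2)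
    (hi _), ← integral_sub hi2 (hi _), mul_left_comm,
    ← integral_const_mul]
  congr 2 with ζ
  have e1 : Complex.exp (Complex.I * (inner ℝ (x + y) ζ : ℝ)) =
      Complex.exp (Complex.I * (inner ℝ x ζ : ℝ)) * Complex.exp ((inner ℝ y ζ : ℝ) * Complex.I) := by
    rw [← Complex.exp_add, inner_add_left]; push_cast; ring_nf
  have e2 : Complex.exp (Complex.I * (inner ℝ (x - y) ζ : ℝ)) =
      Complex.exp (Complex.I * (inner ℝ x ζ : ℝ)) * Complex.exp (-(inner ℝ y ζ : ℝ) * Complex.I) := by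
    rw [← Complex.exp_add, inner_sub_left]; push_cast; ring_nf
  rw [e1, e2, diffSymbol]
  push_cast
  linear_combination (((‖y‖ : ℂ) ^ 3)⁻¹ * Complex.exp (Complex.I * (inner ℝ x ζ : ℝ)) * ft u ζ) *
    Complex.two_cos ((inner ℝ y ζ : ℝ) : ℂ)

lemma IsTest.integral_diffQuot (h : IsTest U u) (x : ℂ) :
    ∫ y, diffQuot u x y = diffConst * opOf (fun _ ζ => (‖ζ‖ : ℂ)) u x := by
  have hint : Integrable (fun p : ℂ × ℂ => Complex.exp (Complex.I * (inner ℝ x p.2 : ℝ)) *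
      ((diffSymbol p.2 p.1 : ℂ) * ft u p.2)) (volume.prod volume) := by
    have i0 := h.integrable_pow_mul_ft 0
    have i2 := h.integrable_pow_mul_ft 2
    have i3 := integrable_weight.mul_prod ((i0.norm.const_mul 4).add i2.norm)
    refine i3.mono' ?_ (Eventually.of_forall fun p => ?_)
    · have c1 : Continuous (fun p : ℂ × ℂ => Complex.exp (Complex.I * (inner ℝ x p.2 : ℝ))) := by
        fun_prop
      have c2 : Continuous (fun p : ℂ × ℂ => ft u p.2) := h.continuous_ft.comp continuous_snd
      have c3 : Measurable (fun p : ℂ × ℂ => (diffSymbol p.2 p.1 : ℂ)) :=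
        (measurable_diffSymbol.comp measurable_swap).complex_ofReal
      exact (c1.measurable.mul (c3.mul c2.measurable)).aestronglyMeasurable
    · rw [norm_mul, norm_mul, norm_exp_I_mul, one_mul, Complex.norm_real,
        Real.norm_of_nonneg (diffSymbol_nonneg _ _)]
      simp only [Pi.add_apply, norm_mul, norm_pow, Complex.norm_real, norm_norm, pow_zero, norm_one]
      calc _ ≤ (4 + ‖p.2‖ ^ 2) * weight p.1 * ‖ft u p.2‖ := by
            gcongr; exact diffSymbol_le _ _
        _ = _ := by ring
  simp only [h.diffQuot_eq]
  rw [integral_const_mul, integral_integral_swap hint, opOf, mul_left_comm,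
    ← integral_const_mul (diffConst : ℂ)]
  congr 2 with ζ
  rw [integral_const_mul, integral_mul_const, integral_complex_ofReal, integral_diffSymbol]
  push_cast
  ring

/-- As `|ζ|û` need not be smooth at `0`, Schwartz decay is not available. Instead `|D|u` is, up to
the nonzero constant, a partial integral of a function in `L¹(dx dy)`. -/
lemma IsTest.integrable_opOf_norm (h : IsTest U u) :
    Integrable (opOf (fun _ ζ => (‖ζ‖ : ℂ)) u) := by
  have h1 := h.integrable_diffQuot.integral_prod_left
  simp only [h.integral_diffQuot] at h1
  have h2 := h1.const_mul (diffConst : ℂ)⁻¹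
  have : (diffConst : ℂ) ≠ 0 := by exact_mod_cast diffConst_pos.ne'
  simpa only [inv_mul_cancel_left₀ this] using h2

/-! ### The filtered inversion -/

lemma opOf_const_mul (c : ℂ) (a : ℂ → ℂ → ℂ) (u : ℂ → ℂ) (x : ℂ) :
    opOf (fun y ζ => c * a y ζ) u x = c * opOf a u x := by
  simp only [opOf, mul_assoc c, mul_left_comm _ c, integral_const_mul]

/-- Inversion in the order transform after inverse transform needs `|D|u ∈ L¹`; this is the purpose
of the second-difference representation. -/
lemma IsTest.ft_opOf_norm (h : IsTest U u) (ζ : ℂ) :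
    ft (opOf (fun _ ζ => (‖ζ‖ : ℂ)) u) ζ = ‖ζ‖ * ft u ζ := by
  set f : ℂ → ℂ := fun w => (‖(2 * Real.pi) • w‖ : ℂ) * 𝓕 u w with hf
  have hfe : f = fun w => (‖(2 * Real.pi) • w‖ : ℂ) * ft u ((2 * Real.pi) • w) := by
    funext w
    rw [ft_eq, smul_smul, inv_mul_cancel₀ (by positivity), one_smul]
  have h0 : opOf (fun _ ζ => (‖ζ‖ : ℂ)) u = 𝓕⁻ f := funext fun x => opOf_eq (fun ζ => (‖ζ‖ : ℂ)) u x
  have h1 : Continuous f := by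
    have := h.continuous_ft
    rw [hfe]; fun_prop
  have h2 : Integrable f := by
    rw [hfe]
    have := (h.integrable_pow_mul_ft 1).comp_smul (R := 2 * Real.pi) (by positivity)
    simpa using this
  have h3 := h.integrable_opOf_norm
  rw [h0] at h3 ⊢
  have h4 : Integrable (𝓕 f) := by
    have := h3.comp_neg
    simpa only [Real.fourierInv_eq_fourier_neg, neg_neg] using this
  rw [ft_eq, h1.fourier_fourierInv_eq h2 h4, hfe]
  simp only [smul_smul]
  rw [mul_inv_cancel₀ (by positivity), one_smul]

lemma ft_const_mul (c : ℂ) (f : ℂ → ℂ) (ζ : ℂ) : ft (fun x => c * f x) ζ = c * ft f ζ := by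
  simp only [ft, mul_left_comm _ c, integral_const_mul]

lemma opOf_normalSymbol (κ : ℝ) (u : ℂ → ℂ) :
    opOf (fun _ ζ => ((2 * Real.pi * κ * ‖ζ‖ : ℝ) : ℂ)) u =
      fun x => (2 * Real.pi * κ : ℂ) * opOf (fun _ ζ => (‖ζ‖ : ℂ)) u x := by
  funext x
  rw [← opOf_const_mul]
  push_cast
  rfl

theorem IsTest.inDomInvSqrtLaplacian_normal (h : IsTest U u) (κ : ℝ) :
    InDomInvSqrtLaplacian (opOf (fun _ ζ => ((2 * Real.pi * κ * ‖ζ‖ : ℝ) : ℂ)) u) := by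
  rw [opOf_normalSymbol]
  refine ⟨h.integrable_opOf_norm.const_mul _, ?_⟩
  simp only [ft_const_mul, h.ft_opOf_norm]
  refine ((h.integrable_pow_mul_ft 0).const_mul (2 * Real.pi * κ : ℂ)).congr ?_
  filter_upwards [compl_mem_ae_iff.2 (measure_singleton (0 : ℂ))] with ζ hζ
  have : (‖ζ‖ : ℂ) ≠ 0 := by simpa using hζ
  field_simp

theorem IsTest.invSqrtLaplacian_normal (h : IsTest U u) (κ : ℝ) (x : ℂ) :
    invSqrtLaplacian (opOf (fun _ ζ => ((2 * Real.pi * κ * ‖ζ‖ : ℝ) : ℂ)) u) x =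
      (2 * Real.pi * κ : ℂ) * u x := by
  rw [opOf_normalSymbol, invSqrtLaplacian, ← h.opOf_one x, ← opOf_const_mul, opOf, opOf]
  congr 1
  refine integral_congr_ae ?_
  -- `|ζ|⁻¹|ζ| = 1` fails only at the origin, a null set.
  filter_upwards [compl_mem_ae_iff.2 (measure_singleton (0 : ℂ))] with ζ hζ
  have : (‖ζ‖ : ℂ) ≠ 0 := by simpa using hζ
  rw [ft_const_mul, h.ft_opOf_norm]
  field_simp

/-! ### Homogeneous symbols -/

lemma contDiffAt_norm_ofReal {ζ : ℂ} (hζ : ζ ≠ 0) :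
    ContDiffAt ℝ ∞ (fun η : ℂ => (‖η‖ : ℂ)) ζ :=
  Complex.ofRealCLM.contDiff.contDiffAt.comp ζ (contDiffAt_norm ℝ hζ)

/-- Differentiate `‖cη‖ = c‖η‖` `j` times: the `j`-th derivative of the norm is homogeneous of
degree `1 - j`. -/
lemma iteratedFDeriv_norm_smul {c : ℝ} (hc : 0 < c) (j : ℕ) {ζ : ℂ} (hζ : ζ ≠ 0) :
    c ^ j • iteratedFDeriv ℝ j (fun η : ℂ => (‖η‖ : ℂ)) (c • ζ) =
      c • iteratedFDeriv ℝ j (fun η : ℂ => (‖η‖ : ℂ)) ζ := by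
  have h1 := (ContinuousLinearEquiv.smulLeft (R₁ := ℝ) (M₁ := ℂ)
    (Units.mk0 c hc.ne')).iteratedFDerivWithin_comp_right (fun η : ℂ => (‖η‖ : ℂ))
    uniqueDiffOn_univ (x := ζ) (mem_univ _) j
  rw [preimage_univ, iteratedFDerivWithin_univ, iteratedFDerivWithin_univ] at h1
  have h2 : ((fun η : ℂ => (‖η‖ : ℂ)) ∘ ContinuousLinearEquiv.smulLeft (R₁ := ℝ) (M₁ := ℂ)
      (Units.mk0 c hc.ne')) = c • fun η : ℂ => (‖η‖ : ℂ) := by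
    funext η
    simp [Units.smul_def, abs_of_pos hc]
  rw [h2, iteratedFDeriv_const_smul_apply
    ((contDiffAt_norm_ofReal hζ).of_le (m := j) (by exact_mod_cast le_top))] at h1
  rw [h1]
  ext v
  have h3 := (iteratedFDeriv ℝ j (fun η : ℂ => (‖η‖ : ℂ)) (c • ζ)).map_smul_univ (fun _ => c) v
  simp only [Finset.prod_const, Finset.card_univ, Fintype.card_fin] at h3
  exact h3.symm

/-- Homogeneity reduces the bound to the unit sphere, where compactness gives it. -/
lemma exists_iteratedFDeriv_norm_le (j : ℕ) : ∃ C : ℝ, 0 ≤ C ∧ ∀ ζ : ℂ, 1 ≤ ‖ζ‖ →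
    ‖iteratedFDeriv ℝ j (fun η : ℂ => (‖η‖ : ℂ)) ζ‖ ≤ C * ‖ζ‖ ^ (1 - j : ℝ) := by
  have hcont : ContinuousOn (iteratedFDeriv ℝ j (fun η : ℂ => (‖η‖ : ℂ)))
      (Metric.sphere (0 : ℂ) 1) := fun ζ hζ => by
    have : ζ ≠ 0 := by rintro rfl; simp at hζ
    exact ((contDiffAt_norm_ofReal this).continuousAt_iteratedFDeriv
      (by exact_mod_cast le_top)).continuousWithinAt
  obtain ⟨C, hC⟩ := (isCompact_sphere (0 : ℂ) 1).exists_bound_of_continuousOn hcont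
  refine ⟨max C 0, le_max_right _ _, fun ζ hζ => ?_⟩
  have h0 : 0 < ‖ζ‖ := by linarith
  have h1 := iteratedFDeriv_norm_smul h0 j
    (smul_ne_zero (inv_ne_zero h0.ne') (norm_pos_iff.1 h0))
  rw [smul_inv_smul₀ h0.ne'] at h1
  have h2 := congrArg norm h1
  rw [norm_smul, norm_smul, norm_pow, norm_norm] at h2
  have h3 := hC (‖ζ‖⁻¹ • ζ) (by
    rw [mem_sphere_zero_iff_norm, norm_smul, norm_inv, norm_norm, inv_mul_cancel₀ h0.ne'])
  rw [Real.rpow_sub h0, Real.rpow_one, Real.rpow_natCast, mul_div_assoc', le_div_iff₀ (by positivity),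
    mul_comm, h2, mul_comm]
  gcongr
  exact h3.trans (le_max_left _ _)

/-- A cutoff which is `1` near the origin and vanishes for `|ζ| ≥ 1/2`. -/
def lowFreq : ContDiffBump (0 : ℂ) := ⟨1 / 4, 1 / 2, by norm_num, by norm_num⟩

/-- The smooth full symbol `c (1 - χ(ζ)) |ζ|`. -/
def normSymbol (c : ℝ) (ζ : ℂ) : ℂ := c * ((1 - lowFreq ζ : ℝ) * (‖ζ‖ : ℂ))

lemma contDiff_normSymbol (c : ℝ) : ContDiff ℝ ∞ (normSymbol c) := by
  refine contDiff_const.mul (contDiff_iff_contDiffAt.2 fun ζ => ?_)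
  rcases eq_or_ne ζ 0 with rfl | hζ
  · have : (fun η : ℂ => ((1 - lowFreq η : ℝ) : ℂ) * (‖η‖ : ℂ)) =ᶠ[𝓝 0] fun _ => 0 := by
      filter_upwards [lowFreq.eventuallyEq_one] with η hη
      simp [hη]
    exact contDiffAt_const.congr_of_eventuallyEq this
  · exact (contDiff_ofReal_comp (contDiff_const.sub lowFreq.contDiff)).contDiffAt.mul
      (contDiffAt_norm_ofReal hζ)

/-- The cutoff radius `1/2` lies strictly below `1`, so agreement holds on a neighbourhood and
passes to all derivatives. -/
lemma normSymbol_eventuallyEq (c : ℝ) {ζ : ℂ} (hζ : 1 ≤ ‖ζ‖) :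
    normSymbol c =ᶠ[𝓝 ζ] fun η => (c : ℂ) * (‖η‖ : ℂ) := by
  have h1 : ∀ᶠ η : ℂ in 𝓝 ζ, 1 / 2 < ‖η‖ :=
    (isOpen_lt continuous_const continuous_norm).mem_nhds (by simp; linarith)
  filter_upwards [h1] with η hη
  have : lowFreq η = 0 := lowFreq.zero_of_le_dist (by
    simp only [dist_zero_right, lowFreq]; exact hη.le)
  simp [normSymbol, this]

lemma symbolBound_of_forall {m r : ℝ} {b : ℂ → ℂ}
    (h : ∀ j : ℕ, ∃ C : ℝ, ∀ ζ : ℂ, r ≤ ‖ζ‖ →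
      ‖iteratedFDeriv ℝ j b ζ‖ ≤ C * (1 + ‖ζ‖) ^ (m - j)) :
    SymbolBound U m r (fun _ => b) := by
  intro L _ _ i j
  rcases Nat.eq_zero_or_pos i with rfl | hi
  · obtain ⟨C, hC⟩ := h j
    refine ⟨C, fun x _ ζ hζ => ?_⟩
    rw [norm_iteratedFDeriv_zero]
    exact hC ζ hζ
  · refine ⟨0, fun x _ ζ _ => ?_⟩
    rw [iteratedFDeriv_const_of_ne hi.ne']
    simp

lemma isSymbol_normSymbol (c : ℝ) : IsSymbol U 1 (fun _ => normSymbol c) := by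
  refine ⟨((contDiff_normSymbol c).comp contDiff_snd).contDiffOn, symbolBound_of_forall fun j => ?_⟩
  obtain ⟨C, hC0, hC⟩ := exists_iteratedFDeriv_norm_le j
  obtain ⟨D, hD⟩ := (isCompact_closedBall (0 : ℂ) 1).exists_bound_of_continuousOn
    (f := fun ζ => iteratedFDeriv ℝ j (normSymbol c) ζ)
    ((contDiff_normSymbol c).continuous_iteratedFDeriv (by exact_mod_cast le_top)).continuousOn
  have hD0 : 0 ≤ D := (norm_nonneg _).trans (hD 0 (by simp))
  -- `1 + |ζ|` is at most `2|ζ|` outside the unit ball and at most `2` inside, so replacing it costs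
  -- at most `2^j` in either region.
  refine ⟨|c| * C * 2 ^ (j : ℝ) + D * 2 ^ (j : ℝ), fun ζ _ => ?_⟩
  have h1 : (0 : ℝ) < 1 + ‖ζ‖ := by positivity
  rcases le_total 1 ‖ζ‖ with hζ | hζ
  · have e1 : ‖iteratedFDeriv ℝ j (normSymbol c) ζ‖ ≤ |c| * (C * ‖ζ‖ ^ (1 - j : ℝ)) := by
      have h0 : ζ ≠ 0 := norm_pos_iff.1 (by linarith)
      rw [(Filter.EventuallyEq.iteratedFDeriv ℝ (normSymbol_eventuallyEq c hζ) j).self_of_nhds]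
      have : iteratedFDeriv ℝ j (fun η : ℂ => (c : ℂ) * (‖η‖ : ℂ)) ζ =
          c • iteratedFDeriv ℝ j (fun η : ℂ => (‖η‖ : ℂ)) ζ := by
        have e := iteratedFDeriv_const_smul_apply (a := c)
          ((contDiffAt_norm_ofReal h0).of_le (m := j) (by exact_mod_cast le_top))
        rw [← e]
        rfl
      rw [this, norm_smul, Real.norm_eq_abs]
      gcongr
      exact hC ζ hζ
    have e2 : ‖ζ‖ ^ (1 - j : ℝ) ≤ 2 ^ (j : ℝ) * (1 + ‖ζ‖) ^ (1 - j : ℝ) := by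
      have h0 : 0 < ‖ζ‖ := by linarith
      rw [Real.rpow_sub h0, Real.rpow_sub h1, Real.rpow_one, Real.rpow_one, mul_div_assoc',
        div_le_div_iff₀ (by positivity) (by positivity)]
      have : (1 + ‖ζ‖) ^ (j : ℝ) ≤ 2 ^ (j : ℝ) * ‖ζ‖ ^ (j : ℝ) := by
        rw [← Real.mul_rpow (by norm_num) h0.le]
        exact Real.rpow_le_rpow h1.le (by linarith) (by positivity)
      calc _ ≤ (1 + ‖ζ‖) * (2 ^ (j : ℝ) * ‖ζ‖ ^ (j : ℝ)) := by gcongr; linarith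
        _ = _ := by ring
    have e3 : 0 ≤ D * 2 ^ (j : ℝ) * (1 + ‖ζ‖) ^ (1 - j : ℝ) := by positivity
    calc _ ≤ |c| * (C * (2 ^ (j : ℝ) * (1 + ‖ζ‖) ^ (1 - j : ℝ))) := e1.trans (by gcongr)
      _ ≤ _ := by linarith
  · have e1 := hD ζ (by simpa using hζ)
    have e2 : 1 ≤ 2 ^ (j : ℝ) * (1 + ‖ζ‖) ^ (1 - j : ℝ) := by
      rw [Real.rpow_sub h1, Real.rpow_one, mul_div_assoc', le_div_iff₀ (by positivity), one_mul]
      have : (1 + ‖ζ‖) ^ (j : ℝ) ≤ 2 ^ (j : ℝ) :=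
        Real.rpow_le_rpow h1.le (by linarith) (by positivity)
      have h5 : (0 : ℝ) ≤ 2 ^ (j : ℝ) := by positivity
      nlinarith [norm_nonneg ζ]
    have e3 : 0 ≤ |c| * C * 2 ^ (j : ℝ) * (1 + ‖ζ‖) ^ (1 - j : ℝ) := by positivity
    have e4 := mul_le_mul_of_nonneg_left e2 hD0
    linarith

lemma symbolBound_normSymbol_sub (c m : ℝ) :
    SymbolBound U m 1 (fun _ ζ => normSymbol c ζ - ((c * ‖ζ‖ : ℝ) : ℂ)) := by
  refine symbolBound_of_forall fun j => ⟨0, fun ζ hζ => ?_⟩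
  have : (fun η => normSymbol c η - ((c * ‖η‖ : ℝ) : ℂ)) =ᶠ[𝓝 ζ] fun _ => 0 := by
    filter_upwards [normSymbol_eventuallyEq c hζ] with η hη
    rw [hη]
    push_cast
    ring
  rw [(Filter.EventuallyEq.iteratedFDeriv ℝ this j).self_of_nhds]
  simp

/-! ### The low frequency part is smoothing -/

/-- The kernel `(2π)⁻² ∫ e^{i (x - y) · ζ} c χ(ζ) |ζ| dζ`. -/
def lowFreqKernel (c : ℝ) (x y : ℂ) : ℂ :=
  ((2 * Real.pi : ℂ) ^ 2)⁻¹ * ∫ ζ : ℂ, ((c * (lowFreq ζ * ‖ζ‖) : ℝ) : ℂ) *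
    Complex.exp (Complex.I * (inner ℝ (x - y) ζ : ℝ))

lemma continuous_lowFreq_weight (c : ℝ) :
    Continuous (fun ζ : ℂ => ((c * (lowFreq ζ * ‖ζ‖) : ℝ) : ℂ)) := by
  have := lowFreq.continuous
  fun_prop

lemma hasCompactSupport_lowFreq_weight (c : ℝ) :
    HasCompactSupport (fun ζ : ℂ => ((c * (lowFreq ζ * ‖ζ‖) : ℝ) : ℂ)) := by
  have h : HasCompactSupport (fun ζ : ℂ => c * (lowFreq ζ * ‖ζ‖)) :=
    (lowFreq.hasCompactSupport.mul_right (f' := fun ζ : ℂ => ‖ζ‖)).mul_left (f := fun _ => c)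
  exact h.comp_left (g := ((↑) : ℝ → ℂ)) (by simp)

/-- Only a compact set of frequencies enters, so differentiation falls on the exponential and the
singularity of `|ζ|` at `0` is harmless. -/
lemma contDiff_lowFreqKernel (c : ℝ) :
    ContDiff ℝ ∞ (fun p : ℂ × ℂ => lowFreqKernel c p.1 p.2) := by
  have hi : Integrable (fun ζ : ℂ => ((c * (lowFreq ζ * ‖ζ‖) : ℝ) : ℂ)) :=
    (continuous_lowFreq_weight c).integrable_of_hasCompactSupport
      (hasCompactSupport_lowFreq_weight c)
  refine contDiff_const.mul (contDiff_integral_mul (hasCompactSupport_lowFreq_weight c).isCompact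
    hi (fun y hy => image_eq_zero_of_notMem_tsupport
      (f := fun ζ : ℂ => ((c * (lowFreq ζ * ‖ζ‖) : ℝ) : ℂ)) hy) (h := fun (p : ℂ × ℂ) ζ =>
      Complex.exp (Complex.I * (inner ℝ (p.1 - p.2) ζ : ℝ))) ?_)
  have : ContDiff ℝ ∞ (fun q : (ℂ × ℂ) × ℂ => inner ℝ (q.1.1 - q.1.2) q.2) :=
    ContDiff.inner ℝ (by fun_prop) (by fun_prop)
  exact (contDiff_const.mul (contDiff_ofReal_comp this)).cexp

lemma IsTest.integral_lowFreqKernel (h : IsTest U u) (c : ℝ) (x : ℂ) :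
    ∫ y, lowFreqKernel c x y * u y =
      opOf (fun _ ζ => ((c * (lowFreq ζ * ‖ζ‖) : ℝ) : ℂ)) u x := by
  have hc := h.contDiff.continuous
  have hw := continuous_lowFreq_weight c
  have hF : Continuous (fun p : ℂ × ℂ => ((c * (lowFreq p.2 * ‖p.2‖) : ℝ) : ℂ) *
      Complex.exp (Complex.I * (inner ℝ (x - p.1) p.2 : ℝ)) * u p.1) := by
    have := hw.comp (continuous_snd (X := ℂ) (Y := ℂ))
    simp only [Function.comp_def] at this
    fun_prop
  have hint := hF.integrable_of_hasCompactSupport (μ := volume.prod volume)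
    (HasCompactSupport.intro
      (h.hasCompactSupport.isCompact.prod (hasCompactSupport_lowFreq_weight c).isCompact)
      fun p hp => by
        rw [mem_prod, not_and_or] at hp
        rcases hp with hp | hp
        · rw [image_eq_zero_of_notMem_tsupport hp, mul_zero]
        · rw [image_eq_zero_of_notMem_tsupport hp, zero_mul, zero_mul])
  simp only [lowFreqKernel, mul_assoc, ← integral_mul_const]
  rw [integral_const_mul, opOf]
  simp only [mul_assoc] at hint
  rw [integral_integral_swap hint]
  congr 2 with ζ
  rw [integral_const_mul, mul_left_comm (Complex.exp _), ft, ← integral_const_mul (Complex.exp _)]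
  congr 2 with y
  rw [← mul_assoc, ← Complex.exp_add, inner_sub_left]
  push_cast
  ring_nf

/-- Split `|ζ| = (1 - χ)|ζ| + χ|ζ|`: the first part is the symbol, the second the smooth kernel. -/
lemma hasFullSymbol_normSymbol (c : ℝ) {A : (ℂ → ℂ) → ℂ → ℂ}
    (hA : ∀ u, IsTest U u → ∀ x ∈ U, A u x = opOf (fun _ ζ => ((c * ‖ζ‖ : ℝ) : ℂ)) u x) :
    HasFullSymbol U A (fun _ => normSymbol c) := by
  refine ⟨lowFreqKernel c, (contDiff_lowFreqKernel c).contDiffOn, fun u h x hx => ?_⟩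
  have hb (b : ℂ → ℂ) (hb : Continuous b) (hbd : ∀ ζ, ‖b ζ‖ ≤ |c| * ‖ζ‖) :
      Integrable (fun ζ : ℂ => Complex.exp (Complex.I * (inner ℝ x ζ : ℝ)) * (b ζ * ft u ζ)) := by
    have := h.continuous_ft
    refine ((h.integrable_pow_mul_ft 1).norm.const_mul |c|).mono'
      (Continuous.aestronglyMeasurable (by fun_prop)) (Eventually.of_forall fun ζ => ?_)
    rw [norm_mul, norm_mul, norm_exp_I_mul, one_mul, norm_mul, pow_one, Complex.norm_real,
      norm_norm, ← mul_assoc]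
    gcongr
    exact hbd ζ
  have hχ : ∀ ζ, 0 ≤ lowFreq ζ ∧ lowFreq ζ ≤ 1 := fun ζ => ⟨lowFreq.nonneg, lowFreq.le_one⟩
  rw [hA u h x hx, h.integral_lowFreqKernel, opOf, opOf, opOf, ← mul_add, ← integral_add]
  · congr 2 with ζ
    rw [normSymbol]
    push_cast
    ring
  · refine hb _ (contDiff_normSymbol c).continuous fun ζ => ?_
    rw [normSymbol, norm_mul, norm_mul, Complex.norm_real, Complex.norm_real, Complex.norm_real,
      norm_norm, Real.norm_eq_abs]
    have h1 := hχ ζ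
    rw [Real.norm_of_nonneg (by linarith)]
    gcongr
    exact mul_le_of_le_one_left (norm_nonneg _) (by linarith)
  · refine hb _ (continuous_lowFreq_weight c) fun ζ => ?_
    rw [Complex.norm_real, norm_mul, norm_mul, norm_norm, Real.norm_eq_abs]
    have h1 := hχ ζ
    rw [Real.norm_of_nonneg (by linarith)]
    gcongr
    exact mul_le_of_le_one_left (norm_nonneg _) (by linarith)

/-- Multipliers `c |ζ|` are pseudodifferential operators with principal symbol `c |ζ|`. -/
lemma hasPrincipalSymbol_norm (c : ℝ) {A : (ℂ → ℂ) → ℂ → ℂ}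
    (hA : ∀ u, IsTest U u → ∀ x ∈ U, A u x = opOf (fun _ ζ => ((c * ‖ζ‖ : ℝ) : ℂ)) u x) :
    HasPrincipalSymbol U 1 A (fun _ ζ => ((c * ‖ζ‖ : ℝ) : ℂ)) := by
  refine ⟨fun p hp => ?_, fun x _ ζ _ t ht => ?_, fun _ => normSymbol c, isSymbol_normSymbol c,
    hasFullSymbol_normSymbol c hA, ?_⟩
  · have h0 : p.2 ≠ 0 := hp.2
    have h1 : ContDiffAt ℝ ∞ (fun ζ : ℂ => ((c * ‖ζ‖ : ℝ) : ℂ)) p.2 :=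
      Complex.ofRealCLM.contDiff.contDiffAt.comp p.2 (contDiffAt_const.mul (contDiffAt_norm ℝ h0))
    exact (h1.comp p contDiffAt_snd).contDiffWithinAt
  · beta_reduce
    rw [norm_mul, Complex.norm_real, Real.norm_of_nonneg ht.le, Real.rpow_one]
    push_cast
    ring
  · exact symbolBound_normSymbol_sub c (1 - 1)

lemma isSymbol_zero (m : ℝ) : IsSymbol U m (fun _ _ => 0) := by
  refine ⟨contDiffOn_const, symbolBound_of_forall fun j => ⟨0, fun ζ _ => ?_⟩⟩
  simp

/-! ### Single scattering -/

lemma hasDerivAt_intervalIntegral_of_contDiff {a b : ℝ} {h : ℝ → ℝ → ℂ}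
    (hh : ContDiff ℝ ∞ (fun q : ℝ × ℝ => h q.1 q.2)) (s : ℝ) :
    HasDerivAt (fun s => ∫ α in a..b, h α s) (∫ α in a..b, deriv (h α) s) s := by
  have h1 := (contDiff_deriv_snd hh).continuous
  obtain ⟨C, hC⟩ := (isCompact_uIcc (a := a) (b := b)).prod (isCompact_closedBall s 1)
    |>.exists_bound_of_continuousOn h1.continuousOn
  refine (intervalIntegral.hasDerivAt_integral_of_dominated_loc_of_deriv_le
    (F := fun s α => h α s) (F' := fun s α => deriv (h α) s) (bound := fun _ => C)
    (Metric.closedBall_mem_nhds s one_pos) (Eventually.of_forall fun s' => ?_) ?_ ?_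
    (Eventually.of_forall fun α hα s' hs' => ?_) intervalIntegrable_const
    (Eventually.of_forall fun α _ s' _ => ?_)).2
  · exact (hh.continuous.comp (continuous_id.prodMk continuous_const)).aestronglyMeasurable
  · exact (hh.continuous.comp (continuous_id.prodMk continuous_const)).intervalIntegrable _ _
  · exact (h1.comp (continuous_id.prodMk continuous_const)).aestronglyMeasurable
  · exact hC (α, s') ⟨uIoc_subset_uIcc hα, hs'⟩
  · have : ContDiff ℝ ∞ (h α) := hh.comp (contDiff_const.prodMk contDiff_id)
    exact (this.differentiable (by simp) s').hasDerivAt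

/-- The integrand `μ(x') / (x - x')` of the solid Cauchy transform. -/
def cauchyIntegrand (mu : ℂ → ℂ) (x x' : ℂ) : ℂ := (x - x')⁻¹ * mu x'

variable {mu : ℂ → ℂ}

/-- The pole `x' = x` lies on the circle, off the support of `μ` in the open disc. Off that support
the integrand vanishes locally, pole included. -/
lemma IsTest.contDiff_cauchyIntegrand (h : IsTest disc mu) :
    ContDiff ℝ ∞ (fun q : ℝ × ℂ => cauchyIntegrand mu (circleMap 0 1 q.1) q.2) := by
  refine contDiff_iff_contDiffAt.2 fun q => ?_
  by_cases hq : q.2 ∈ tsupport mu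
  · have hne : circleMap 0 1 q.1 - q.2 ≠ 0 := fun h0 => by
      have h1 : ‖q.2‖ < 1 := by simpa [disc] using h.2.2 hq
      rw [← sub_eq_zero.1 h0, norm_circleMap_zero] at h1
      simp at h1
    have h2 : ContDiff ℝ ∞ (fun q : ℝ × ℂ => circleMap 0 1 q.1) :=
      (contDiff_circleMap 0 1).comp contDiff_fst
    exact ((h2.sub contDiff_snd).contDiffAt.inv hne).mul (h.contDiff.comp contDiff_snd).contDiffAt
  · have : (fun q : ℝ × ℂ => cauchyIntegrand mu (circleMap 0 1 q.1) q.2) =ᶠ[𝓝 q] fun _ => 0 := by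
      have h1 : ∀ᶠ p : ℝ × ℂ in 𝓝 q, p.2 ∈ (tsupport mu)ᶜ :=
        continuous_snd.continuousAt.eventually
          ((isClosed_tsupport mu).isOpen_compl.mem_nhds hq)
      filter_upwards [h1] with p hp
      simp [cauchyIntegrand, image_eq_zero_of_notMem_tsupport hp]
    exact contDiffAt_const.congr_of_eventuallyEq this

lemma IsTest.isTest_cauchyIntegrand (h : IsTest disc mu) (α : ℝ) :
    IsTest disc (cauchyIntegrand mu (circleMap 0 1 α)) :=
  ⟨ContDiff.comp (g := fun q : ℝ × ℂ => cauchyIntegrand mu (circleMap 0 1 q.1) q.2)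
      (f := fun x : ℂ => (α, x)) h.contDiff_cauchyIntegrand (contDiff_const.prodMk contDiff_id),
    h.hasCompactSupport.mul_left (f := fun x' => (circleMap 0 1 α - x')⁻¹),
    (tsupport_mul_subset_right (f := fun x' => (circleMap 0 1 α - x')⁻¹)).trans h.2.2⟩

lemma IsTest.contDiff_radon_cauchyIntegrand (h : IsTest disc mu) (θ : ℝ) :
    ContDiff ℝ ∞ (fun q : ℝ × ℝ => radon (cauchyIntegrand mu (circleMap 0 1 q.1)) θ q.2) := by
  obtain ⟨R, -, hR⟩ := h.exists_radius
  have h1 := contDiff_radon_param (F := fun α : ℝ => cauchyIntegrand mu (circleMap 0 1 α))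
    h.contDiff_cauchyIntegrand (fun α x hx => by rw [cauchyIntegrand, hR x hx, mul_zero])
  exact ContDiff.comp (g := fun q : ℝ × ℝ × ℝ =>
      radon (cauchyIntegrand mu (circleMap 0 1 q.1)) q.2.1 q.2.2)
    (f := fun q : ℝ × ℝ => (q.1, θ, q.2)) h1
    (contDiff_fst.prodMk (contDiff_const.prodMk contDiff_snd))

/-- With `k = τe^{iφ}` one has `2 Re(kx') = 2τ n_{-φ}·x'`, so the Cauchy transform is a slice at
frequency `2τ`, and the factor `k̄` becomes a derivative in `s`. -/
lemma singleScattering_eq (h : IsTest disc mu) (α τ φ : ℝ) :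
    singleScattering mu (circleMap 0 1 α) (τ * Complex.exp (Complex.I * φ)) =
      -(2 * Real.pi : ℂ)⁻¹ * Complex.exp (-(Complex.I * φ)) *
        ftLine (deriv (radon (cauchyIntegrand mu (circleMap 0 1 α)) (-φ))) (2 * τ) := by
  have hF := h.isTest_cauchyIntegrand α
  have hconj : conj (Complex.exp (Complex.I * φ)) = Complex.exp (-(Complex.I * φ)) := by
    rw [← Complex.exp_conj]; simp
  rw [ftLine_deriv (hF.contDiff_radon_snd _) (hF.hasCompactSupport_radon _), hF.ftLine_radon, ft,
    singleScattering, cauchyTransform, map_mul, Complex.conj_ofReal, hconj]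
  have h1 : ∀ x' : ℂ, (circleMap 0 1 α - x')⁻¹ *
      (eNeg (τ * Complex.exp (Complex.I * φ)) x' * mu x') =
      Complex.exp (-(Complex.I * (inner ℝ x' (((2 * τ : ℝ) : ℂ) *
        Complex.exp (Complex.I * (-φ : ℝ))) : ℝ))) *
        cauchyIntegrand mu (circleMap 0 1 α) x' := fun x' => by
    have h2 : inner ℝ x' (((2 * τ : ℝ) : ℂ) * Complex.exp (Complex.I * (-φ : ℝ))) =
        2 * (τ * Complex.exp (Complex.I * φ) * x').re := by
      have h3 : Complex.exp (Complex.I * (-φ : ℝ)) = conj (Complex.exp (Complex.I * φ)) := by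
        rw [hconj]; push_cast; rw [mul_neg]
      rw [real_inner_comm, Complex.inner, map_mul, Complex.conj_ofReal, h3, Complex.conj_conj]
      push_cast
      rw [mul_comm x', mul_assoc 2, mul_assoc 2, show (2 : ℂ) = ((2 : ℝ) : ℂ) by norm_num,
        Complex.re_ofReal_mul]
    rw [eNeg, cauchyIntegrand, h2]
    push_cast
    ring_nf
  simp only [h1]
  have : (Real.pi : ℂ) ≠ 0 := by simp [Real.pi_ne_zero]
  push_cast
  field_simp

lemma integrable_singleScattering (h : IsTest disc mu) (α φ : ℝ) :
    Integrable (fun τ : ℝ =>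
      singleScattering mu (circleMap 0 1 α) (τ * Complex.exp (Complex.I * φ))) := by
  have hF := h.isTest_cauchyIntegrand α
  simp only [singleScattering_eq h]
  exact ((integrable_ftLine (contDiff_deriv (hF.contDiff_radon_snd _))
    (hF.hasCompactSupport_radon _).deriv).comp_mul_left' two_ne_zero).const_mul _

/-- Fourier inversion in `σ = 2τ` at `s = -t/2`; this is where the scaling in `T1a` originates. -/
lemma T1_eq_T1a (h : IsTest disc mu) (α t φ : ℝ) :
    T1 mu (circleMap 0 1 α) t φ = T1a (cauchyIntegrand mu (circleMap 0 1 α)) t φ := by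
  have hF := h.isTest_cauchyIntegrand α
  set G := radon (cauchyIntegrand mu (circleMap 0 1 α)) (-φ) with hG
  have h1 := integral_exp_mul_ftLine (contDiff_deriv (hF.contDiff_radon_snd (-φ)))
    (hF.hasCompactSupport_radon (-φ)).deriv (-t / 2)
  rw [← hG] at h1
  have h2 := Measure.integral_comp_mul_left (fun σ : ℝ =>
    Complex.exp (Complex.I * σ * ((-t / 2 : ℝ) : ℂ)) * ftLine (deriv G) σ) 2
  rw [h1, Complex.real_smul, abs_of_pos (by norm_num)] at h2
  have h3 : ∀ τ : ℝ, Complex.exp (-(Complex.I * t * τ)) *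
      singleScattering mu (circleMap 0 1 α) (τ * Complex.exp (Complex.I * φ)) =
      (-(2 * Real.pi : ℂ)⁻¹ * Complex.exp (-(Complex.I * φ))) *
      (Complex.exp (Complex.I * ((2 * τ : ℝ) : ℂ) * ((-t / 2 : ℝ) : ℂ)) *
        ftLine (deriv G) (2 * τ)) := fun τ => by
    rw [singleScattering_eq h, ← hG, mul_left_comm]
    congr 3
    push_cast
    ring
  rw [T1]
  simp only [h3]
  rw [integral_const_mul, h2, hF.T1a_eq, ← hG]
  have : (Real.pi : ℂ) ≠ 0 := by simp [Real.pi_ne_zero]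
  push_cast
  field_simp

lemma IsTest.continuous_T1a_cauchyIntegrand (h : IsTest disc mu) (t φ : ℝ) :
    Continuous (fun α : ℝ => T1a (cauchyIntegrand mu (circleMap 0 1 α)) t φ) := by
  simp only [fun α => (h.isTest_cauchyIntegrand α).T1a_eq t φ]
  have h1 := (contDiff_deriv_snd
    (h := fun (α : ℝ) s => radon (cauchyIntegrand mu (circleMap 0 1 α)) (-φ) s)
    (h.contDiff_radon_cauchyIntegrand (-φ))).continuous
  have h2 := h1.comp (continuous_id.prodMk (continuous_const (y := -t / 2)))
  exact continuous_const.mul (continuous_const.mul h2)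

lemma circleIntegrable_T1 (h : IsTest disc mu) (t φ : ℝ) :
    CircleIntegrable (fun x => T1 mu x t φ) 0 1 := by
  rw [CircleIntegrable]
  simp only [T1_eq_T1a h]
  exact (h.continuous_T1a_cauchyIntegrand t φ).intervalIntegrable _ _

/-- Cauchy's formula for `1/(x - w)` inside the disc; outside, both sides vanish with `μ`. -/
lemma circleIntegral_cauchyIntegrand (h : IsTest disc mu) (w : ℂ) :
    ∫ α in (0 : ℝ)..(2 * Real.pi),
      deriv (circleMap 0 1) α * cauchyIntegrand mu (circleMap 0 1 α) w =
      2 * Real.pi * Complex.I * mu w := by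
  by_cases hw : w ∈ disc
  · have h1 := circleIntegral.integral_sub_inv_of_mem_ball hw
    rw [circleIntegral] at h1
    simp only [smul_eq_mul] at h1
    simp only [cauchyIntegrand, ← mul_assoc]
    rw [intervalIntegral.integral_mul_const, h1]
  · have : mu w = 0 := image_eq_zero_of_notMem_tsupport fun h' => hw (h.2.2 h')
    simp [cauchyIntegrand, this]

lemma circleIntegral_radon_cauchyIntegrand (h : IsTest disc mu) (θ s : ℝ) :
    ∫ α in (0 : ℝ)..(2 * Real.pi),
      deriv (circleMap 0 1) α * radon (cauchyIntegrand mu (circleMap 0 1 α)) θ s =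
      2 * Real.pi * Complex.I * radon mu θ s := by
  obtain ⟨R, -, hR⟩ := h.exists_radius
  have hswap := intervalIntegral_integral_swap (ν := (volume : Measure ℝ)) (a := 0)
    (b := 2 * Real.pi) (by positivity) (isCompact_Icc (a := -R) (b := R))
    (F := fun α r => deriv (circleMap 0 1) α *
      cauchyIntegrand mu (circleMap 0 1 α) (rotCoord θ (s, r))) ?_ fun α r hr => ?_
  · simp only [radon_eq, ← integral_const_mul]
    rw [hswap]
    simp only [circleIntegral_cauchyIntegrand h]
  · have h1 : Continuous (fun p : ℝ × ℝ => (p.1, rotCoord θ (s, p.2))) := by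
      unfold rotCoord; fun_prop
    have h2 : Continuous (deriv (circleMap 0 1)) :=
      (contDiff_circleMap (n := ∞) 0 1).continuous_deriv (by simp)
    have h3 := h.contDiff_cauchyIntegrand.continuous
    exact (Continuous.comp (g := deriv (circleMap 0 1)) (f := fun p : ℝ × ℝ => p.1) h2
      continuous_fst).mul (Continuous.comp
      (g := fun q : ℝ × ℂ => cauchyIntegrand mu (circleMap 0 1 q.1) q.2)
      (f := fun p : ℝ × ℝ => (p.1, rotCoord θ (s, p.2))) h3 h1)
  · have : R < ‖rotCoord θ (s, r)‖ := by
      refine lt_of_lt_of_le ?_ (le_norm_rotCoord_snd _ _ _)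
      contrapose! hr
      exact abs_le.1 hr
    simp only [cauchyIntegrand, hR _ this, mul_zero]

/-- Differentiate the averaged Radon identity under the circle integral; uniqueness of the
derivative identifies the average of `T₁ᵃF_x` with `T₁ᵃμ`. -/
theorem boundaryAverage_eq_T1a (h : IsTest disc mu) (t φ : ℝ) :
    boundaryAverage mu t φ = T1a mu t φ := by
  have hsm : ContDiff ℝ ∞ (fun q : ℝ × ℝ => deriv (circleMap 0 1) q.1 *
      radon (cauchyIntegrand mu (circleMap 0 1 q.1)) (-φ) q.2) :=
    ((contDiff_deriv (contDiff_circleMap 0 1)).comp contDiff_fst).mul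
      (h.contDiff_radon_cauchyIntegrand (-φ))
  have h1 := hasDerivAt_intervalIntegral_of_contDiff (a := 0) (b := 2 * Real.pi) (h := fun α s =>
    deriv (circleMap 0 1) α * radon (cauchyIntegrand mu (circleMap 0 1 α)) (-φ) s) hsm (-t / 2)
  simp only [circleIntegral_radon_cauchyIntegrand h] at h1
  have h2 := ((h.contDiff_radon_snd (-φ)).differentiable (by simp) (-t / 2)).hasDerivAt.const_mul
    (2 * Real.pi * Complex.I)
  have h3 := h1.unique h2
  have h4 : ∀ α : ℝ, deriv (circleMap 0 1) α * T1a (cauchyIntegrand mu (circleMap 0 1 α)) t φ =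
      (Complex.exp (-(Complex.I * φ)) * -(1 / 2)) * deriv (fun s => deriv (circleMap 0 1) α *
        radon (cauchyIntegrand mu (circleMap 0 1 α)) (-φ) s) (-t / 2) := fun α => by
    rw [deriv_const_mul_field, (h.isTest_cauchyIntegrand α).T1a_eq]
    ring
  rw [boundaryAverage, circleIntegral]
  simp only [T1_eq_T1a h, smul_eq_mul, h4]
  rw [intervalIntegral.integral_const_mul, h3, h.T1a_eq]
  have : (Real.pi : ℂ) ≠ 0 := by simp [Real.pi_ne_zero]
  field_simp

/-! ### The normal operator -/

theorem IsAdjointT1a.normal_eq {κ : ℝ} {S : (ℝ → ℝ → ℂ) → ℂ → ℂ} (hS : IsAdjointT1a κ S)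
    {U : Set ℂ} {mu : ℂ → ℂ} (h : IsTest U mu) :
    S (T1a mu) = opOf (fun _ ζ => ((2 * Real.pi * κ * ‖ζ‖ : ℝ) : ℂ)) mu := by
  rw [hS.eq_backProj h.isTestCyl_T1a]
  exact funext (backProj_T1a_eq_opOf h κ)

/-- Filtered back-projection is exact. -/
theorem IsAdjointT1a.invSqrtLaplacian_normal {κ : ℝ} (hκ : 0 < κ) {S : (ℝ → ℝ → ℂ) → ℂ → ℂ}
    (hS : IsAdjointT1a κ S) {U : Set ℂ} {mu : ℂ → ℂ} (h : IsTest U mu) (x : ℂ) :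
    (2 * Real.pi * κ : ℂ)⁻¹ * invSqrtLaplacian (S (T1a mu)) x = mu x := by
  rw [hS.normal_eq h, h.invSqrtLaplacian_normal κ x, inv_mul_cancel_left₀]
  have h1 : (Real.pi : ℂ) ≠ 0 := by simp [Real.pi_ne_zero]
  have h2 : (κ : ℂ) ≠ 0 := by exact_mod_cast hκ.ne'
  exact mul_ne_zero (mul_ne_zero two_ne_zero h1) h2

lemma isPDO_zero (U : Set ℂ) (m : ℝ) : IsPDO U m (fun _ _ => 0) :=
  ⟨fun _ _ => 0, isSymbol_zero m, fun _ _ => 0, contDiffOn_const, fun u _ x _ => by simp [opOf]⟩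

lemma isIntegralOperator_zero (U : Set ℂ) : IsIntegralOperator U (fun _ _ => 0) :=
  ⟨fun _ _ => 0, (locallyIntegrable_const (0 : ℂ)).locallyIntegrableOn _,
    fun u _ x _ => ⟨by simp, by simp⟩⟩

end CGORadon

end

open CGORadon in
theorem mainTheorem1 (κ : ℝ) (hκ : 0 < κ) :
    -- the boundary average of the single scattering term is a differentiated Radon transform
    (∀ mu, IsTest disc mu → ∀ t φ : ℝ,
      (∀ x ∈ Metric.sphere (0 : ℂ) 1, MeasureTheory.Integrable
        (fun τ : ℝ => singleScattering mu x (τ * Complex.exp (Complex.I * φ)))) ∧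
      CircleIntegrable (fun x => T1 mu x t φ) 0 1 ∧
      boundaryAverage mu t φ = T1a mu t φ) ∧
    -- the averaged operator maps test functions to test functions and has an adjoint
    (∀ mu, IsTest Set.univ mu →
      ContDiff ℝ ∞ (fun p : ℝ × ℝ => radon mu p.1 p.2) ∧ IsTestCyl (T1a mu)) ∧
    (∃ S, IsAdjointT1a κ S) ∧
    ∀ S, IsAdjointT1a κ S →
      -- the normal operator is pseudodifferential of order one
      IsPDO disc 1 (fun mu => S (T1a mu)) ∧
      HasPrincipalSymbol disc 1 (fun mu => S (T1a mu))
        (fun _ ζ => ((2 * Real.pi * κ * ‖ζ‖ : ℝ) : ℂ)) ∧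
      -- filtered back-projection
      ∃ K : (ℂ → ℂ) → ℂ → ℂ,
        IsPDO disc (-1) K ∧ IsIntegralOperator disc K ∧
        ∀ mu, IsTest disc mu →
          InDomInvSqrtLaplacian (S (T1a mu)) ∧
          ∀ x ∈ disc,
            (2 * Real.pi * κ : ℂ)⁻¹ * invSqrtLaplacian (S (T1a mu)) x = mu x + K mu x := by
  refine ⟨fun mu h t φ => ⟨fun x hx => ?_, circleIntegrable_T1 h t φ, boundaryAverage_eq_T1a h t φ⟩,
    fun mu h => ⟨h.contDiff_radon, h.isTestCyl_T1a⟩, ⟨backProj κ, isAdjointT1a_backProj κ⟩,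
    fun S hS => ?_⟩
  · rw [← abs_one, ← range_circleMap] at hx
    obtain ⟨α, rfl⟩ := hx
    exact integrable_singleScattering h α φ
  · have hA : ∀ u, IsTest disc u → ∀ x ∈ disc, S (T1a u) x =
        opOf (fun _ ζ => ((2 * Real.pi * κ * ‖ζ‖ : ℝ) : ℂ)) u x := fun u h x _ => by
      rw [hS.normal_eq h]
    -- The witness for `K` is `0`, since filtered back-projection has no error term.
    refine ⟨⟨fun _ => normSymbol (2 * Real.pi * κ), isSymbol_normSymbol _,
      hasFullSymbol_normSymbol _ hA⟩, hasPrincipalSymbol_norm _ hA, fun _ _ => 0,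
      isPDO_zero _ _, isIntegralOperator_zero _, fun mu h => ⟨?_, fun x _ => ?_⟩⟩
    · rw [hS.normal_eq h]
      exact h.inDomInvSqrtLaplacian_normal κ
    · rw [hS.invSqrtLaplacian_normal hκ h, add_zero]
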